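/- **Syntax.** Fix a set of base types. Simple types are $\sigma,\tau ::= \mathbf{Prop}\mid b\mid 1\mid \sigma\times\tau\mid 0\mid \sigma+\tau\mid \sigma\to\mathbf{Prop}$ with $b$ a base type. A signature consists of base types, basic operators $\mathbf{op}$ with an arity $\mathrm{ar}(\mathbf{op})$ and a coarity $\mathrm{car}(\mathbf{op})$ (simple types), and atomic predicates $ap$ whose arity $\mathrm{ar}(ap)$ is a finite product of base types and $\mathbf{Prop}$; among them are always $\le\,:\mathbf{Prop}\times\mathbf{Prop}$ and $=_b\,:b\times b$ for each base type $b$. Simply typed terms of $\lambda_{\mathrm{HFL}}$ are $$M,N ::= x\mid \mathbf{op}(M)\mid ()\mid (M,N)\mid \pi_1M\mid \pi_2M\mid \mathsf{case}_0\,M\mid \iota_1M\mid\iota_2M\mid \mathsf{case}\,M\,\{\iota_1x_1\mapsto N_1;\ \iota_2x_2\mapsto N_2\}\mid \lambda x.M\mid M\,N\mid \mathsf{fix}\,f.M ,$$ with the standard typing rules, where $\lambda x.M:\sigma\to\mathbf{Prop}$ requires $M:\mathbf{Prop}$, and $\mathsf{fix}\,f.M:\sigma\to\mathbf{Prop}$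 requires $M:\sigma\to\mathbf{Prop}$ in the context extended by $f:\sigma\to\mathbf{Prop}$. Formulas are $\phi,\psi ::= ap(M)\mid\top\mid\bot\mid\phi\Rightarrow\psi\mid\phi\wedge\psi\mid\phi\vee\psi$ with $M:\mathrm{ar}(ap)$. Refinement types are $$\dot\sigma,\dot\tau ::= \{v:\sigma\mid\phi\}\mid (x:\dot\sigma)\to\{v:\mathbf{Prop}\mid\phi\}\mid (x:\dot\sigma)\times\dot\tau\mid 0\mid\dot\sigma+\dot\tau ,$$ where in $\{v:\sigma\mid\phi\}$ the type $\sigma$ is a base type, $\mathbf{Prop}$ or $1$. A refinement context is a list $\dot\Gamma=x_1:\dot\sigma_1,\dots,x_n:\dot\sigma_n$, each $\dot\sigma_i$ being well-formed over $x_1,\dots,x_{i-1}$. Forgetting all formulas gives the underlying simple types and contexts $|\dot\sigma|$, $|\dot\Gamma|$. All terms, formulas and types below are well-formed. **Models.** Let $C$ be an $\omega\mathrm{CPO}$-enriched bicartesian closed category: a bicartesian closed category whose hom-sets are $\omega$-cpos, whose composition is Scott-continuous, and for which the bijections given by pairing, currying and copairing are isomorphisms of $\omega$-cpos. A *bottom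 element* of an object $A$ is a least element of $C(1,A)$. Suppose that $C$ admits a lifting strong monad: each object $X$ has a free object-with-bottom-element $X_\bot$ (free with respect to morphisms that preserve the bottom elements), and the induced monad $(-)_\bot$ is strong. A $\lambda_{\mathrm{HFL}}$-model in $C$ consists of an object $[\![b]\!]$ for each base type $b$, an object $\Omega=[\![\mathbf{Prop}]\!]$ with a bottom element $\bot$, and a morphism $a(\mathbf{op}):[\![\mathrm{ar}(\mathbf{op})]\!]\to[\![\mathrm{car}(\mathbf{op})]\!]$ for each $\mathbf{op}$, together with a subset $P(ap)\subseteq C(1,[\![\mathrm{ar}(ap)]\!])$ for each atomic predicate; here $P(\le)$ is the order of $C(1,\Omega)$ and $P(=_b)$ is equality on $C(1,[\![b]\!])$. Types, contexts and terms are interpreted in the usual way by the bicartesian closed structure: $[\![\sigma\to\mathbf{Prop}]\!]=\Omega^{[\![\sigma]\!]}$, $[\![\Gamma]\!]$ is a product, and $[\![\Gamma\vdash M:\sigma]\!]:[\![\Gamma]\!]\to[\![\sigma]\!]$. Moreover $[\![\mathsf{fix}\,f.M]\!]=\sup_nF^n(\bot)$, where $F(h)=[\![M]\!]\circ\langle\mathrm{id},h\rangle$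 on $C([\![\Gamma]\!],\Omega^{[\![\sigma]\!]})$ and $\bot$ is the least element of this hom-set. *Formulas.* A formula $\phi$ over $\Gamma$ denotes the set $[\![\phi]\!]\subseteq C(1,[\![\Gamma]\!])$ given by $[\![ap(M)]\!]=\{\gamma\mid[\![M]\!]\circ\gamma\in P(ap)\}$ and the Boolean set operations for the connectives. A closed formula $\phi$ is *true in the model* if $[\![\phi]\!]=C(1,1)$. *Refinement types and contexts.* A refinement context $\dot\Gamma$ denotes a set $[\![\dot\Gamma]\!]\subseteq C(1,[\![|\dot\Gamma|]\!])$: the empty context denotes $C(1,1)$, and (writing $(\gamma,u)$ for points $\gamma$ of $[\![|\dot\Gamma|]\!]$ and $u$ of $[\![|\dot\sigma|]\!]$) - $(\gamma,u)\in[\![\dot\Gamma,v:\{v:\sigma\mid\phi\}]\!]$ iff $\gamma\in[\![\dot\Gamma]\!]$ and $(\gamma,u)\in[\![\phi]\!]$; - $(\gamma,f)\in[\![\dot\Gamma,f:(x:\dot\sigma)\to\{v:\mathbf{Prop}\mid\phi\}]\!]$ iff $\gamma\in[\![\dot\Gamma]\!]$ and, for every point $u$ with $(\gamma,u)\in[\![\dot\Gamma,x:\dot\sigma]\!]$,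 $(\gamma,u,\mathrm{ev}(f,u))\in[\![\phi]\!]$; - $(\gamma,(u,w))\in[\![\dot\Gamma,z:(x:\dot\sigma)\times\dot\tau]\!]$ iff $(\gamma,u,w)\in[\![\dot\Gamma,x:\dot\sigma,y:\dot\tau]\!]$; - $[\![\dot\Gamma,x:0]\!]=\emptyset$; - $[\![\dot\Gamma,z:\dot\sigma+\dot\tau]\!]=\{(\gamma,\iota_1\circ u)\mid(\gamma,u)\in[\![\dot\Gamma,x:\dot\sigma]\!]\}\cup\{(\gamma,\iota_2\circ w)\mid(\gamma,w)\in[\![\dot\Gamma,y:\dot\tau]\!]\}$. A formula $\phi$ over $\Gamma,v:\mathbf{Prop}$ is *admissible at $v$* if, for each $\gamma\in C(1,[\![\Gamma]\!])$, the set $\{u\in C(1,\Omega)\mid(\gamma,u)\in[\![\phi]\!]\}$ contains $\bot$ and is closed under suprema of $\omega$-chains. **Subtyping.** $\dot\Gamma\vdash\dot\sigma<:\dot\tau$ (for types with $|\dot\sigma|=|\dot\tau|$) is the least reflexive and transitive relation such that: - $\{v:\sigma\mid\phi\}<:\{v:\sigma\mid\psi\}$ if $(\gamma,u)\in[\![\psi]\!]$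 for all $(\gamma,u)\in[\![\dot\Gamma,v:\{v:\sigma\mid\phi\}]\!]$; - $(x:\dot\sigma_1)\to\dot\tau_1<:(x:\dot\sigma_2)\to\dot\tau_2$ if $\dot\Gamma\vdash\dot\sigma_2<:\dot\sigma_1$ and $\dot\Gamma,x:\dot\sigma_2\vdash\dot\tau_1<:\dot\tau_2$ (where $\dot\tau_i=\{v:\mathbf{Prop}\mid\phi_i\}$); - $(x:\dot\sigma_1)\times\dot\tau_1<:(x:\dot\sigma_2)\times\dot\tau_2$ if $\dot\Gamma\vdash\dot\sigma_1<:\dot\sigma_2$ and $\dot\Gamma,x:\dot\sigma_1\vdash\dot\tau_1<:\dot\tau_2$; - $\dot\sigma_1+\dot\tau_1<:\dot\sigma_2+\dot\tau_2$ if $\dot\Gamma\vdash\dot\sigma_1<:\dot\sigma_2$ and $\dot\Gamma\vdash\dot\tau_1<:\dot\tau_2$. **Typing.** $\dot\Gamma\vdash M:\dot\sigma$ is the least relation closed under the following rules. - (App) If $\dot\Gamma\vdash M:(x:\dot\sigma)\to\{v:\mathbf{Prop}\mid\phi\}$ and $\dot\Gamma\vdash N:\dot\sigma$, then $\dot\Gamma\vdash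 M\,N:\{v:\mathbf{Prop}\mid\phi[N/x]\}$. - (Abs) If $\dot\Gamma,x:\dot\sigma\vdash M:\{v:\mathbf{Prop}\mid\phi\}$, then $\dot\Gamma\vdash\lambda x.M:(x:\dot\sigma)\to\{v:\mathbf{Prop}\mid\phi\}$. - (Unit) $\dot\Gamma\vdash():\{v:1\mid\top\}$. - (Pair) If $\dot\Gamma\vdash M:\dot\sigma$ and $\dot\Gamma\vdash N:\dot\tau[M/x]$, then $\dot\Gamma\vdash(M,N):(x:\dot\sigma)\times\dot\tau$. - (Fst), (Snd) If $\dot\Gamma\vdash M:(x:\dot\sigma)\times\dot\tau$, then $\dot\Gamma\vdash\pi_1M:\dot\sigma$ and $\dot\Gamma\vdash\pi_2M:\dot\tau[\pi_1M/x]$. - (Case0) If $\dot\Gamma\vdash M:0$, then $\dot\Gamma\vdash\mathsf{case}_0\,M:\dot\tau$ for every $\dot\tau$ over $\dot\Gamma$ whose underlying type is that of $\mathsf{case}_0\,M$. - (Inj) If $\dot\Gamma\vdash M:\dot\sigma_i$, then $\dot\Gamma\vdash\iota_iM:\dot\sigma_1+\dot\sigma_2$ $(i=1,2)$. - (Case2)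 If $\dot\Gamma\vdash M:\dot\sigma_1+\dot\sigma_2$ and $\dot\Gamma,x_i:\dot\sigma_i\vdash N_i:\dot\tau[\iota_ix_i/z]$ for $i=1,2$, then $\dot\Gamma\vdash\mathsf{case}\,M\,\{\iota_1x_1\mapsto N_1;\ \iota_2x_2\mapsto N_2\}:\dot\tau[M/z]$. - (VarRefine) If $x$ is a variable of $\dot\Gamma$ of base type $b$, then $\dot\Gamma\vdash x:\{v:b\mid v=_bx\}$. - (Var) If $x:\dot\sigma$ is in $\dot\Gamma$, then $\dot\Gamma\vdash x:\dot\sigma$. - (Sub) If $\dot\Gamma\vdash M:\dot\sigma$ and $\dot\Gamma\vdash\dot\sigma<:\dot\tau$, then $\dot\Gamma\vdash M:\dot\tau$. - (Fix) Let $\dot\tau=(x:\dot\sigma)\to\{v:\mathbf{Prop}\mid\phi\}$. If $\dot\Gamma,f:\dot\tau\vdash M:\dot\tau$, with $\phi$ not mentioning $f$, and $\phi$ is admissible at $v$, then $\dot\Gamma\vdash\mathsf{fix}\,f.M:\dot\tau$. - (BasicOp) If $\dot\Gamma\vdash M:\dot\sigma$, $\mathrm{ar}(\mathbf{op})=|\dot\sigma|$,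 $\mathrm{car}(\mathbf{op})=|\dot\tau|$, and $(\gamma,a(\mathbf{op})\circ u)\in[\![\dot\Gamma,v:\dot\tau]\!]$ for all $(\gamma,u)\in[\![\dot\Gamma,v:\dot\sigma]\!]$, then $\dot\Gamma\vdash\mathbf{op}(M):\dot\tau$. **Corollary (soundness).** In every $\lambda_{\mathrm{HFL}}$-model, for every closed term $M:\sigma$ and every formula $\phi$ over $v:\sigma$: if $\vdash M:\{v:\sigma\mid\phi\}$ is derivable in the empty context, then the closed formula $\phi[M/v]$ is true in the model. -/

import Mathlib

/-!
The calculus is presented with well-typed de Bruijn syntax: a term `Tm S Γ σ` is a term of simple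
type `σ` in the simple context `Γ`, a formula `Fml S Γ` is a well-formed formula over `Γ`, and a
refinement type `RTy S Γ σ` is a refinement type over `Γ` with underlying simple type `σ`.  Contexts
are lists whose head is the most recently bound variable.
-/

open CategoryTheory MonoidalCategory CartesianMonoidalCategory Limits OmegaCompletePartialOrder

universe w v u

namespace HFL

/-! ### Simple types, signatures, terms and formulas -/

/-- Simple types over a set `B` of base types; `fn σ` is the function type `σ → Prop`. -/
inductive Ty (B : Type w) : Type w
  | prop : Ty B
  | base (b : B) : Ty B
  | unit : Ty B
  | prod (σ τ : Ty B) : Ty B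
  | empty : Ty B
  | sum (σ τ : Ty B) : Ty B
  | fn (σ : Ty B) : Ty B

/-- The simple types that can be refined directly: base types, `Prop` and `1`. -/
inductive Ty.IsGround {B : Type w} : Ty B → Prop
  | base (b : B) : IsGround (.base b)
  | prop : IsGround .prop
  | unit : IsGround .unit

/-- Finite products of base types and `Prop`. -/
inductive Ty.IsFinProd {B : Type w} : Ty B → Prop
  | base (b : B) : IsFinProd (.base b)
  | prop : IsFinProd .prop
  | unit : IsFinProd .unit
  | prod {σ τ : Ty B} : IsFinProd σ → IsFinProd τ → IsFinProd (.prod σ τ)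

/-- A signature: base types, basic operators with arity and coarity, and atomic predicates (other
than the order on `Prop` and the equalities on base types, which are added in `Atom`). -/
structure Sig where
  Base : Type w
  Op : Type w
  ar : Op → Ty Base
  car : Op → Ty Base
  Pred : Type w
  predAr : Pred → Ty Base
  predAr_isFinProd : ∀ p, (predAr p).IsFinProd

/-- Simple contexts. -/
abbrev Ctx (S : Sig.{w}) : Type w := List (Ty S.Base)

/-- Variables of type `σ` in a context (de Bruijn indices). -/
inductive Var (S : Sig.{w}) : Ctx S → Ty S.Base → Type w
  | z {Γ : Ctx S} {σ : Ty S.Base} : Var S (σ :: Γ) σ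
  | s {Γ : Ctx S} {σ τ : Ty S.Base} : Var S Γ σ → Var S (τ :: Γ) σ

/-- Well-typed terms `Γ ⊢ M : σ`. -/
inductive Tm (S : Sig.{w}) : Ctx S → Ty S.Base → Type w
  | var {Γ : Ctx S} {σ : Ty S.Base} (x : Var S Γ σ) : Tm S Γ σ
  | op {Γ : Ctx S} (o : S.Op) (M : Tm S Γ (S.ar o)) : Tm S Γ (S.car o)
  | unit {Γ : Ctx S} : Tm S Γ .unit
  | pair {Γ : Ctx S} {σ τ : Ty S.Base} (M : Tm S Γ σ) (N : Tm S Γ τ) : Tm S Γ (.prod σ τ)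
  | fst {Γ : Ctx S} {σ τ : Ty S.Base} (M : Tm S Γ (.prod σ τ)) : Tm S Γ σ
  | snd {Γ : Ctx S} {σ τ : Ty S.Base} (M : Tm S Γ (.prod σ τ)) : Tm S Γ τ
  | case0 {Γ : Ctx S} {τ : Ty S.Base} (M : Tm S Γ .empty) : Tm S Γ τ
  | inl {Γ : Ctx S} {σ τ : Ty S.Base} (M : Tm S Γ σ) : Tm S Γ (.sum σ τ)
  | inr {Γ : Ctx S} {σ τ : Ty S.Base} (M : Tm S Γ τ) : Tm S Γ (.sum σ τ)
  | case2 {Γ : Ctx S} {σ₁ σ₂ τ : Ty S.Base} (M : Tm S Γ (.sum σ₁ σ₂))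
      (N₁ : Tm S (σ₁ :: Γ) τ) (N₂ : Tm S (σ₂ :: Γ) τ) : Tm S Γ τ
  | lam {Γ : Ctx S} {σ : Ty S.Base} (M : Tm S (σ :: Γ) .prop) : Tm S Γ (.fn σ)
  | app {Γ : Ctx S} {σ : Ty S.Base} (M : Tm S Γ (.fn σ)) (N : Tm S Γ σ) : Tm S Γ .prop
  | fix {Γ : Ctx S} {σ : Ty S.Base} (M : Tm S (.fn σ :: Γ) (.fn σ)) : Tm S Γ (.fn σ)

/-- Atomic predicates: the order on `Prop`, equality on each base type, and those of the
signature. -/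
inductive Atom (S : Sig.{w}) : Type w
  | le : Atom S
  | eq (b : S.Base) : Atom S
  | other (p : S.Pred) : Atom S

/-- The arity of an atomic predicate. -/
def Atom.ar {S : Sig.{w}} : Atom S → Ty S.Base
  | .le => .prod .prop .prop
  | .eq b => .prod (.base b) (.base b)
  | .other p => S.predAr p

/-- Well-formed formulas `Γ ⊢ φ`. -/
inductive Fml (S : Sig.{w}) : Ctx S → Type w
  | atom {Γ : Ctx S} (a : Atom S) (M : Tm S Γ a.ar) : Fml S Γ
  | top {Γ : Ctx S} : Fml S Γ
  | bot {Γ : Ctx S} : Fml S Γ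
  | imp {Γ : Ctx S} (φ ψ : Fml S Γ) : Fml S Γ
  | and {Γ : Ctx S} (φ ψ : Fml S Γ) : Fml S Γ
  | or {Γ : Ctx S} (φ ψ : Fml S Γ) : Fml S Γ

/-- Refinement types whose formulas are well-formed over `Γ`, indexed by their underlying type:
`{v : σ | φ}`, `(x : σ̇) → {v : Prop | φ}`, `(x : σ̇) × τ̇`, `0` and `σ̇ + τ̇`. -/
inductive RTy (S : Sig.{w}) : Ctx S → Ty S.Base → Type w
  | refine {Γ : Ctx S} {σ : Ty S.Base} (h : σ.IsGround) (φ : Fml S (σ :: Γ)) : RTy S Γ σ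
  | pi {Γ : Ctx S} {σ : Ty S.Base} (A : RTy S Γ σ) (φ : Fml S (.prop :: σ :: Γ)) :
      RTy S Γ (.fn σ)
  | sigma {Γ : Ctx S} {σ τ : Ty S.Base} (A : RTy S Γ σ) (B : RTy S (σ :: Γ) τ) :
      RTy S Γ (.prod σ τ)
  | empty {Γ : Ctx S} : RTy S Γ .empty
  | sum {Γ : Ctx S} {σ τ : Ty S.Base} (A : RTy S Γ σ) (B : RTy S Γ τ) : RTy S Γ (.sum σ τ)

/-- Well-formed refinement contexts, indexed by their underlying simple context. -/
inductive RCtx (S : Sig.{w}) : Ctx S → Type w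
  | nil : RCtx S []
  | cons {Γ : Ctx S} {σ : Ty S.Base} (D : RCtx S Γ) (A : RTy S Γ σ) : RCtx S (σ :: Γ)

/-! ### Renaming and capture-avoiding substitution -/

section Substitution

variable {S : Sig.{w}}

/-- Renamings: each variable of `Γ` is sent to a variable of `Δ`. -/
abbrev Ren (Γ Δ : Ctx S) : Type w := ∀ σ : Ty S.Base, Var S Γ σ → Var S Δ σ

/-- A renaming extended to one more bound variable. -/
def Ren.lift {Γ Δ : Ctx S} (r : Ren Γ Δ) (τ : Ty S.Base) : Ren (τ :: Γ) (τ :: Δ)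
  | _, .z => .z
  | _, .s x => .s (r _ x)

def Tm.rename {Γ Δ : Ctx S} {σ : Ty S.Base} (r : Ren Γ Δ) : Tm S Γ σ → Tm S Δ σ
  | .var x => .var (r _ x)
  | .op o M => .op o (M.rename r)
  | .unit => .unit
  | .pair M N => .pair (M.rename r) (N.rename r)
  | .fst M => .fst (M.rename r)
  | .snd M => .snd (M.rename r)
  | .case0 M => .case0 (M.rename r)
  | .inl M => .inl (M.rename r)
  | .inr M => .inr (M.rename r)
  | .case2 M N₁ N₂ => .case2 (M.rename r) (N₁.rename (r.lift _)) (N₂.rename (r.lift _))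
  | .lam M => .lam (M.rename (r.lift _))
  | .app M N => .app (M.rename r) (N.rename r)
  | .fix M => .fix (M.rename (r.lift _))

/-- Simultaneous substitutions: each variable of `Γ` is sent to a term over `Δ`. -/
abbrev Sub (Γ Δ : Ctx S) : Type w := ∀ σ : Ty S.Base, Var S Γ σ → Tm S Δ σ

/-- A substitution extended to one more bound variable. -/
def Sub.lift {Γ Δ : Ctx S} (s : Sub Γ Δ) (τ : Ty S.Base) : Sub (τ :: Γ) (τ :: Δ)
  | _, .z => .var .z
  | _, .s x => (s _ x).rename fun _ y => .s y

/-- The substitution `[M/x]` for the last variable `x` of the context. -/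
def Sub.single {Γ : Ctx S} {τ : Ty S.Base} (M : Tm S Γ τ) : Sub (τ :: Γ) Γ
  | _, .z => M
  | _, .s x => .var x

/-- Weakening by one variable. -/
def Sub.wk (Γ : Ctx S) (τ : Ty S.Base) : Sub Γ (τ :: Γ) :=
  fun _ x => .var (.s x)

/-- The substitution `[M/z]` from `Γ, z : ρ` to `Γ, x : τ`, where `M` may use `x`. -/
def Sub.replace {Γ : Ctx S} {ρ τ : Ty S.Base} (M : Tm S (τ :: Γ) ρ) : Sub (ρ :: Γ) (τ :: Γ)
  | _, .z => M
  | _, .s x => .var (.s x)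

def Tm.subst {Γ Δ : Ctx S} {σ : Ty S.Base} (s : Sub Γ Δ) : Tm S Γ σ → Tm S Δ σ
  | .var x => s _ x
  | .op o M => .op o (M.subst s)
  | .unit => .unit
  | .pair M N => .pair (M.subst s) (N.subst s)
  | .fst M => .fst (M.subst s)
  | .snd M => .snd (M.subst s)
  | .case0 M => .case0 (M.subst s)
  | .inl M => .inl (M.subst s)
  | .inr M => .inr (M.subst s)
  | .case2 M N₁ N₂ => .case2 (M.subst s) (N₁.subst (s.lift _)) (N₂.subst (s.lift _))
  | .lam M => .lam (M.subst (s.lift _))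
  | .app M N => .app (M.subst s) (N.subst s)
  | .fix M => .fix (M.subst (s.lift _))

def Fml.subst {Γ Δ : Ctx S} (s : Sub Γ Δ) : Fml S Γ → Fml S Δ
  | .atom a M => .atom a (M.subst s)
  | .top => .top
  | .bot => .bot
  | .imp φ ψ => .imp (φ.subst s) (ψ.subst s)
  | .and φ ψ => .and (φ.subst s) (ψ.subst s)
  | .or φ ψ => .or (φ.subst s) (ψ.subst s)

def RTy.subst {Γ Δ : Ctx S} {σ : Ty S.Base} (s : Sub Γ Δ) : RTy S Γ σ → RTy S Δ σ
  | .refine h φ => .refine h (φ.subst (s.lift _))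
  | .pi A φ => .pi (A.subst s) (φ.subst ((s.lift _).lift _))
  | .sigma A B => .sigma (A.subst s) (B.subst (s.lift _))
  | .empty => .empty
  | .sum A B => .sum (A.subst s) (B.subst s)

/-- The refinement type that a context assigns to a variable, weakened to the whole context. -/
def RCtx.lookup : {Γ : Ctx S} → RCtx S Γ → {σ : Ty S.Base} → Var S Γ σ → RTy S Γ σ
  | _, .cons _ A, _, .z => A.subst (Sub.wk _ _)
  | _, .cons D _, _, .s x => (D.lookup x).subst (Sub.wk _ _)

end Substitution

/-! ### Categories with the structure of a model -/

section Categories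

variable (C : Type u) [Category.{v} C] [CartesianMonoidalCategory C] [MonoidalClosed C]
  [HasFiniteCoproducts C]

/-- `ωCPO`-enrichment of a bicartesian closed category: hom-sets are `ω`-cpos, composition is
Scott-continuous, and the bijections given by pairing, currying and copairing are isomorphisms of
`ω`-cpos. (Their inverses are monotone since composition is, so it suffices to ask that they are
monotone.) -/
class OmegaCPOEnriched where
  homOrder : ∀ X Y : C, OmegaCompletePartialOrder (X ⟶ Y)
  comp_continuous : ∀ X Y Z : C,
    ωScottContinuous (fun p : (X ⟶ Y) × (Y ⟶ Z) => p.1 ≫ p.2)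
  lift_mono : ∀ {X Y Z : C} {f f' : X ⟶ Y} {g g' : X ⟶ Z},
    f ≤ f' → g ≤ g' → lift f g ≤ lift f' g'
  curry_mono : ∀ {X Y Z : C} {f f' : X ⊗ Y ⟶ Z},
    f ≤ f' → MonoidalClosed.curry f ≤ MonoidalClosed.curry f'
  desc_mono : ∀ {X Y Z : C} {f f' : X ⟶ Z} {g g' : Y ⟶ Z},
    f ≤ f' → g ≤ g' → coprod.desc f g ≤ coprod.desc f' g'

attribute [reducible, instance] OmegaCPOEnriched.homOrder

variable [OmegaCPOEnriched C]

/-- Free algebras for the theory of one constant `⊥` with `⊥ ≤ x`. An algebra is an object `A` with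
a bottom element, that is, a least element of `C(1, A)`; homomorphisms preserve it. -/
structure Lifting where
  obj : C → C
  bot : ∀ X : C, 𝟙_ C ⟶ obj X
  isBot : ∀ X : C, IsBot (bot X)
  unit : ∀ X : C, X ⟶ obj X
  ext : ∀ {X A : C} (a : 𝟙_ C ⟶ A), IsBot a → (X ⟶ A) → (obj X ⟶ A)
  unit_ext : ∀ {X A : C} (a : 𝟙_ C ⟶ A) (ha : IsBot a) (f : X ⟶ A), unit X ≫ ext a ha f = f
  bot_ext : ∀ {X A : C} (a : 𝟙_ C ⟶ A) (ha : IsBot a) (f : X ⟶ A), bot X ≫ ext a ha f = a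
  ext_unique : ∀ {X A : C} (a : 𝟙_ C ⟶ A) (ha : IsBot a) (f : X ⟶ A) (g : obj X ⟶ A),
    unit X ≫ g = f → bot X ≫ g = a → g = ext a ha f

variable {C}

/-- The functorial action of the induced monad. -/
def Lifting.map (T : Lifting C) {X Y : C} (f : X ⟶ Y) : T.obj X ⟶ T.obj Y :=
  T.ext (T.bot Y) (T.isBot Y) (f ≫ T.unit Y)

/-- The multiplication of the induced monad. -/
def Lifting.mult (T : Lifting C) (X : C) : T.obj (T.obj X) ⟶ T.obj X :=
  T.ext (T.bot X) (T.isBot X) (𝟙 (T.obj X))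

variable (C)

/-- A lifting whose induced monad is strong. -/
structure StrongLifting extends Lifting C where
  strength : ∀ X Y : C, X ⊗ obj Y ⟶ obj (X ⊗ Y)
  strength_natural : ∀ {X X' Y Y' : C} (f : X ⟶ X') (g : Y ⟶ Y'),
    (f ⊗ₘ toLifting.map g) ≫ strength X' Y' = strength X Y ≫ toLifting.map (f ⊗ₘ g)
  strength_leftUnitor : ∀ X : C,
    strength (𝟙_ C) X ≫ toLifting.map (λ_ X).hom = (λ_ (obj X)).hom
  strength_assoc : ∀ X Y Z : C,
    strength (X ⊗ Y) Z ≫ toLifting.map (α_ X Y Z).hom =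
      (α_ X Y (obj Z)).hom ≫ X ◁ strength Y Z ≫ strength X (Y ⊗ Z)
  strength_unit : ∀ X Y : C, X ◁ unit Y ≫ strength X Y = unit (X ⊗ Y)
  strength_mult : ∀ X Y : C,
    X ◁ toLifting.mult Y ≫ strength X Y =
      strength X (obj Y) ≫ toLifting.map (strength X Y) ≫ toLifting.mult (X ⊗ Y)

/-- The category admits a lifting strong monad. -/
class AdmitsStrongLifting : Prop where
  exists_strongLifting : Nonempty (StrongLifting C)

variable {C}

theorem comp_le_comp {X Y Z : C} {f f' : X ⟶ Y} {g g' : Y ⟶ Z} (hf : f ≤ f') (hg : g ≤ g') :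
    f ≫ g ≤ f' ≫ g' :=
  (OmegaCPOEnriched.comp_continuous X Y Z).monotone
    (show ((f, g) : (X ⟶ Y) × (Y ⟶ Z)) ≤ (f', g') from ⟨hf, hg⟩)

/-- In a category with a lifting strong monad, a bottom element of `A` yields a least element of
every `C(X, A)`. -/
theorem toUnit_comp_le [AdmitsStrongLifting C] {A : C} {a : 𝟙_ C ⟶ A} (ha : IsBot a) {X : C}
    (f : X ⟶ A) : toUnit X ≫ a ≤ f := by
  obtain ⟨T⟩ := AdmitsStrongLifting.exists_strongLifting (C := C)
  -- the structure map of the algebra `A`, and that of the exponential algebra `X ⇒ A`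
  let ν : T.obj A ⟶ A := T.ext a ha (𝟙 A)
  let E : C := (ihom X).obj A
  let α : T.obj E ⟶ E := MonoidalClosed.curry
    (T.strength X E ≫ T.toLifting.map ((ihom.ev X).app A) ≫ ν)
  have hmap : ∀ {Y Z : C} (g : Y ⟶ Z), T.unit Y ≫ T.toLifting.map g = g ≫ T.unit Z :=
    fun g => T.unit_ext _ _ _
  have hmapb : ∀ {Y Z : C} (g : Y ⟶ Z), T.bot Y ≫ T.toLifting.map g = T.bot Z :=
    fun g => T.bot_ext _ _ _
  have hmapc : ∀ {Y Z W : C} (g : Y ⟶ Z) (h : Z ⟶ W),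
      T.toLifting.map (g ≫ h) = T.toLifting.map g ≫ T.toLifting.map h := by
    intro Y Z W g h
    symm
    apply T.ext_unique
    · rw [← Category.assoc, hmap, Category.assoc, hmap, Category.assoc]
    · rw [← Category.assoc, hmapb, hmapb]
  have hα : T.unit E ≫ α = 𝟙 E := by
    rw [← MonoidalClosed.curry_natural_left]
    rw [← Category.assoc, T.strength_unit, ← Category.assoc, hmap, Category.assoc,
      T.unit_ext]
    erw [Category.comp_id]
    rw [MonoidalClosed.curry_eq_iff, MonoidalClosed.uncurry_id_eq_ev]
  have hsnd : ∀ Y : C, T.strength X Y ≫ T.toLifting.map (snd X Y) = snd X (T.obj Y) := by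
    intro Y
    have h1 : snd X Y = (toUnit X ⊗ₘ 𝟙 Y) ≫ (λ_ Y).hom := by
      rw [leftUnitor_hom, tensorHom_snd, Category.comp_id]
    have hid : T.toLifting.map (𝟙 Y) = 𝟙 (T.obj Y) := by
      symm
      apply T.ext_unique <;> simp
    rw [h1, hmapc, ← Category.assoc, ← T.strength_natural, Category.assoc,
      T.strength_leftUnitor, hid, leftUnitor_hom, tensorHom_snd, Category.comp_id]
  have hb : X ◁ (T.bot E ≫ α) ≫ (ihom.ev X).app A = toUnit (X ⊗ 𝟙_ C) ≫ a := by
    rw [← MonoidalClosed.uncurry_eq, MonoidalClosed.uncurry_natural_left,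
      MonoidalClosed.uncurry_curry]
    have h0 : X ◁ initial.to E ≫ (ihom.ev X).app A = snd X (⊥_ C) ≫ initial.to A := by
      have : IsInitial (X ⊗ ⊥_ C) :=
        IsInitial.ofIso initialIsInitial (zeroMul initialIsInitial).symm
      exact this.hom_ext _ _
    rw [← hmapb (initial.to E), MonoidalCategory.whiskerLeft_comp, Category.assoc]
    have hn := T.strength_natural (𝟙 X) (initial.to E)
    rw [id_tensorHom, id_tensorHom] at hn
    rw [← Category.assoc (X ◁ T.toLifting.map (initial.to E)), hn, Category.assoc,
      ← Category.assoc (T.toLifting.map (X ◁ initial.to E)), ← hmapc, h0, hmapc, Category.assoc,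
      ← Category.assoc (T.strength X (⊥_ C)), hsnd, ← Category.assoc, whiskerLeft_snd,
      Category.assoc, ← Category.assoc (T.bot (⊥_ C)), hmapb, T.bot_ext]
    congr 1
    exact toUnit_unique _ _
  -- compare the bottom element of `X ⇒ A` with the name of `f`
  have hle : T.bot E ≫ α ≤ MonoidalClosed.curry (fst X (𝟙_ C) ≫ f) := by
    have h := comp_le_comp (T.isBot E (MonoidalClosed.curry (fst X (𝟙_ C) ≫ f) ≫ T.unit E))
      (le_refl α)
    rwa [Category.assoc, hα, Category.comp_id] at h
  have h := comp_le_comp (OmegaCPOEnriched.lift_mono (le_refl (𝟙 X))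
    (comp_le_comp (le_refl (toUnit X)) hle)) (le_refl ((ihom.ev X).app A))
  have key : ∀ g : 𝟙_ C ⟶ E, lift (𝟙 X) (toUnit X ≫ g) ≫ (ihom.ev X).app A =
      lift (𝟙 X) (toUnit X) ≫ X ◁ g ≫ (ihom.ev X).app A := by
    intro g
    rw [← Category.assoc, lift_whiskerLeft]
  rw [key, key, hb, ← MonoidalClosed.uncurry_eq, MonoidalClosed.uncurry_curry,
    ← Category.assoc, ← Category.assoc, lift_fst, Category.id_comp] at h
  rwa [toUnit_unique (toUnit X) (lift (𝟙 X) (toUnit X) ≫ toUnit (X ⊗ 𝟙_ C))]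

/-- The least element of `C(X, B ⇒ A)`, for `A` with a bottom element `a`. -/
def botHom {A : C} (a : 𝟙_ C ⟶ A) (X B : C) : X ⟶ (ihom B).obj A :=
  MonoidalClosed.curry (toUnit (B ⊗ X) ≫ a)

theorem botHom_le [AdmitsStrongLifting C] {A : C} {a : 𝟙_ C ⟶ A} (ha : IsBot a) {X B : C}
    (f : X ⟶ (ihom B).obj A) : botHom a X B ≤ f := by
  rw [← MonoidalClosed.curry_uncurry f]
  exact OmegaCPOEnriched.curry_mono (toUnit_comp_le ha _)

/-- For `f : X × E → E`, the map `h ↦ f ∘ ⟨id, h⟩` on `C(X, E)`. -/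
def fixStep {X E : C} (f : X ⊗ E ⟶ E) : (X ⟶ E) →o (X ⟶ E) where
  toFun h := lift (𝟙 X) h ≫ f
  monotone' _ _ h := comp_le_comp (OmegaCPOEnriched.lift_mono le_rfl h) le_rfl

/-- The parameterised fixed point `f† : X → (B ⇒ A)` of `f : X × (B ⇒ A) → (B ⇒ A)`: the supremum
of the iterates of `h ↦ f ∘ ⟨id, h⟩` from the least element. -/
def dagger [AdmitsStrongLifting C] {A : C} {a : 𝟙_ C ⟶ A} (ha : IsBot a) {X B : C}
    (f : X ⊗ (ihom B).obj A ⟶ (ihom B).obj A) : X ⟶ (ihom B).obj A :=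
  ωSup (fixedPoints.iterateChain (fixStep f) (botHom a X B) (botHom_le ha _))

end Categories

/-! ### Models and the interpretation of types and terms -/

section Semantics

variable {S : Sig.{w}} {C : Type u} [Category.{v} C] [CartesianMonoidalCategory C]
  [MonoidalClosed C] [HasFiniteCoproducts C]

/-- The interpretation of types, given that of base types and of `Prop`. -/
noncomputable def Ty.obj {B : Type w} (base : B → C) (Ω : C) : Ty B → C
  | .prop => Ω
  | .base b => base b
  | .unit => 𝟙_ C
  | .prod σ τ => σ.obj base Ω ⊗ τ.obj base Ω
  | .empty => ⊥_ C
  | .sum σ τ => σ.obj base Ω ⨿ τ.obj base Ω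
  | .fn σ => (ihom (σ.obj base Ω)).obj Ω

variable [OmegaCPOEnriched C]

variable (S C) in
/-- A model in `C` of the signature `S`. -/
structure Model where
  base : S.Base → C
  Ω : C
  bot : 𝟙_ C ⟶ Ω
  isBot : IsBot bot
  op : ∀ o : S.Op, (S.ar o).obj base Ω ⟶ (S.car o).obj base Ω

namespace Model

/-- The interpretation of types. -/
noncomputable abbrev ty (A : Model S C) (σ : Ty S.Base) : C := σ.obj A.base A.Ω

/-- The interpretation of contexts. -/
noncomputable def ctx (A : Model S C) : Ctx S → C
  | [] => 𝟙_ C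
  | σ :: Γ => A.ctx Γ ⊗ A.ty σ

/-- The point `⟨γ, x⟩` of `⟦Γ⟧ × ⟦σ⟧`. -/
noncomputable abbrev cons (A : Model S C) {Γ : Ctx S} {σ : Ty S.Base} (γ : 𝟙_ C ⟶ A.ctx Γ)
    (x : 𝟙_ C ⟶ A.ty σ) : 𝟙_ C ⟶ A.ctx (σ :: Γ) :=
  lift γ x

/-- The first component of a point of `⟦Γ⟧ × ⟦σ⟧`. -/
noncomputable abbrev tail (A : Model S C) {Γ : Ctx S} {σ : Ty S.Base}
    (δ : 𝟙_ C ⟶ A.ctx (σ :: Γ)) : 𝟙_ C ⟶ A.ctx Γ :=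
  δ ≫ fst (A.ctx Γ) (A.ty σ)

/-- The second component of a point of `⟦Γ⟧ × ⟦σ⟧`. -/
noncomputable abbrev head (A : Model S C) {Γ : Ctx S} {σ : Ty S.Base}
    (δ : 𝟙_ C ⟶ A.ctx (σ :: Γ)) : 𝟙_ C ⟶ A.ty σ :=
  δ ≫ snd (A.ctx Γ) (A.ty σ)

/-- The interpretation of variables. -/
noncomputable def var (A : Model S C) : {Γ : Ctx S} → {σ : Ty S.Base} → Var S Γ σ →
    (A.ctx Γ ⟶ A.ty σ)
  | _ :: Γ, σ, .z => snd (A.ctx Γ) (A.ty σ)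
  | τ :: Γ, _, .s x => fst (A.ctx Γ) (A.ty τ) ≫ A.var x

/-- The interpretation of terms. -/
noncomputable def tm [AdmitsStrongLifting C] (A : Model S C) :
    {Γ : Ctx S} → {σ : Ty S.Base} → Tm S Γ σ → (A.ctx Γ ⟶ A.ty σ)
  | _, _, .var x => A.var x
  | _, _, .op o M => A.tm M ≫ A.op o
  | Γ, _, .unit => toUnit (A.ctx Γ)
  | _, _, .pair M N => lift (A.tm M) (A.tm N)
  | _, _, .fst (σ := σ) (τ := τ) M => A.tm M ≫ fst (A.ty σ) (A.ty τ)
  | _, _, .snd (σ := σ) (τ := τ) M => A.tm M ≫ snd (A.ty σ) (A.ty τ)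
  | _, τ, .case0 M => A.tm M ≫ initial.to (A.ty τ)
  | _, _, .inl (σ := σ) (τ := τ) M => A.tm M ≫ (coprod.inl : A.ty σ ⟶ A.ty σ ⨿ A.ty τ)
  | _, _, .inr (σ := σ) (τ := τ) M => A.tm M ≫ (coprod.inr : A.ty τ ⟶ A.ty σ ⨿ A.ty τ)
  | Γ, _, .case2 (σ₁ := σ₁) (σ₂ := σ₂) M N₁ N₂ =>
      lift (𝟙 (A.ctx Γ)) (A.tm M) ≫ (leftDistrib (A.ctx Γ) (A.ty σ₁) (A.ty σ₂)).inv ≫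
        coprod.desc (A.tm N₁) (A.tm N₂)
  | Γ, _, .lam (σ := σ) M =>
      MonoidalClosed.curry (lift (snd (A.ty σ) (A.ctx Γ)) (fst (A.ty σ) (A.ctx Γ)) ≫ A.tm M)
  | _, _, .app (σ := σ) M N => lift (A.tm N) (A.tm M) ≫ (ihom.ev (A.ty σ)).app A.Ω
  | _, _, .fix M => dagger A.isBot (A.tm M)

end Model

/-! ### Interpretation of formulas, refinement types and refinement contexts -/

/-- An interpretation of the atomic predicates of the signature in a model. -/
abbrev PredInterp (A : Model S C) : Type _ :=
  ∀ p : S.Pred, Set (𝟙_ C ⟶ A.ty (S.predAr p))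

/-- The interpretation of atomic predicates: `≤` on `Prop` is the order of `C(1, Ω)` and `=` on a
base type is equality. -/
def PredInterp.atom {A : Model S C} (P : PredInterp A) :
    (a : Atom S) → Set (𝟙_ C ⟶ A.ty a.ar)
  | .le => {p : 𝟙_ C ⟶ A.Ω ⊗ A.Ω | p ≫ fst A.Ω A.Ω ≤ p ≫ snd A.Ω A.Ω}
  | .eq b => {p : 𝟙_ C ⟶ A.base b ⊗ A.base b |
      p ≫ fst (A.base b) (A.base b) = p ≫ snd (A.base b) (A.base b)}
  | .other p => P p

variable [AdmitsStrongLifting C] {A : Model S C} (P : PredInterp A)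

/-- The interpretation of a formula over `Γ` as a set of points of the interpretation of `Γ`. -/
def Fml.sem : {Γ : Ctx S} → Fml S Γ → Set (𝟙_ C ⟶ A.ctx Γ)
  | _, .atom a M => {γ | γ ≫ A.tm M ∈ P.atom a}
  | _, .top => Set.univ
  | _, .bot => ∅
  | _, .imp φ ψ => {γ | γ ∈ φ.sem → γ ∈ ψ.sem}
  | _, .and φ ψ => φ.sem ∩ ψ.sem
  | _, .or φ ψ => φ.sem ∪ ψ.sem

/-- The predicate `π₁* Q ∧ ⟦φ⟧` on `Γ, v : σ` interpreting `{v : σ | φ}` over a context with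
predicate `Q`. -/
def refineSem {Γ : Ctx S} {σ : Ty S.Base} (φ : Fml S (σ :: Γ)) (Q : Set (𝟙_ C ⟶ A.ctx Γ)) :
    Set (𝟙_ C ⟶ A.ctx (σ :: Γ)) :=
  {δ | A.tail δ ∈ Q ∧ δ ∈ φ.sem P}

/-- The interpretation of a refinement type over a context whose predicate is `Q`, as a set of
points of `⟦Γ⟧ × ⟦σ⟧`. -/
def RTy.sem : {Γ : Ctx S} → {σ : Ty S.Base} → RTy S Γ σ → Set (𝟙_ C ⟶ A.ctx Γ) →
    Set (𝟙_ C ⟶ A.ctx (σ :: Γ))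
  | _, _, .refine _ φ, Q => refineSem P φ Q
  | _, _, .pi (σ := σ) B φ, Q =>
      {δ | A.tail δ ∈ Q ∧
        ∀ x : 𝟙_ C ⟶ A.ty σ, A.cons (A.tail δ) x ∈ B.sem Q →
          A.cons (σ := .prop) (A.cons (A.tail δ) x)
            (lift x (A.head δ) ≫ (ihom.ev (A.ty σ)).app A.Ω) ∈ refineSem P φ (B.sem Q)}
  | _, _, .sigma (σ := σ) (τ := τ) B D, Q =>
      {δ | A.cons (A.cons (A.tail δ) (A.head δ ≫ fst (A.ty σ) (A.ty τ)))
        (A.head δ ≫ snd (A.ty σ) (A.ty τ)) ∈ D.sem (B.sem Q)}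
  | _, _, .empty, _ => ∅
  | Γ, _, .sum (σ := σ) (τ := τ) B D, Q =>
      {δ | (∃ f ∈ B.sem Q, δ = f ≫ A.ctx Γ ◁ (coprod.inl : A.ty σ ⟶ A.ty σ ⨿ A.ty τ)) ∨
          ∃ g ∈ D.sem Q, δ = g ≫ A.ctx Γ ◁ (coprod.inr : A.ty τ ⟶ A.ty σ ⨿ A.ty τ)}

/-- The interpretation of a refinement context as a set of points. -/
def RCtx.sem : {Γ : Ctx S} → RCtx S Γ → Set (𝟙_ C ⟶ A.ctx Γ)
  | _, .nil => Set.univ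
  | _, .cons D B => B.sem P D.sem

/-- The formula `φ` over `Γ, v : Prop` is admissible at `v`. -/
def Admissible {Γ : Ctx S} (φ : Fml S (.prop :: Γ)) : Prop :=
  ∀ γ : 𝟙_ C ⟶ A.ctx Γ,
    A.cons (σ := .prop) γ A.bot ∈ φ.sem P ∧
    ∀ c : Chain (𝟙_ C ⟶ A.Ω),
      (∀ n, A.cons (σ := .prop) γ (c n) ∈ φ.sem P) →
        A.cons (σ := .prop) γ (ωSup c) ∈ φ.sem P

/-! ### Subtyping and typing -/

/-- The subtyping relation `Γ̇ ⊢ σ̇ <: τ̇`. -/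
inductive IsSubtype : {Γ : Ctx S} → {σ : Ty S.Base} → RCtx S Γ → RTy S Γ σ → RTy S Γ σ → Prop
  | refl {Γ : Ctx S} {σ : Ty S.Base} (D : RCtx S Γ) (B : RTy S Γ σ) : IsSubtype D B B
  | trans {Γ : Ctx S} {σ : Ty S.Base} {D : RCtx S Γ} {B₁ B₂ B₃ : RTy S Γ σ} :
      IsSubtype D B₁ B₂ → IsSubtype D B₂ B₃ → IsSubtype D B₁ B₃
  | refine {Γ : Ctx S} {σ : Ty S.Base} {D : RCtx S Γ} (h : σ.IsGround) {φ ψ : Fml S (σ :: Γ)} :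
      refineSem P φ (D.sem P) ⊆ ψ.sem P → IsSubtype D (.refine h φ) (.refine h ψ)
  | pi {Γ : Ctx S} {σ : Ty S.Base} {D : RCtx S Γ} {B₁ B₂ : RTy S Γ σ}
      {φ₁ φ₂ : Fml S (.prop :: σ :: Γ)} :
      IsSubtype D B₂ B₁ → IsSubtype (D.cons B₂) (.refine .prop φ₁) (.refine .prop φ₂) →
        IsSubtype D (.pi B₁ φ₁) (.pi B₂ φ₂)
  | sigma {Γ : Ctx S} {σ τ : Ty S.Base} {D : RCtx S Γ} {B₁ B₂ : RTy S Γ σ}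
      {E₁ E₂ : RTy S (σ :: Γ) τ} :
      IsSubtype D B₁ B₂ → IsSubtype (D.cons B₁) E₁ E₂ → IsSubtype D (.sigma B₁ E₁) (.sigma B₂ E₂)
  | sum {Γ : Ctx S} {σ τ : Ty S.Base} {D : RCtx S Γ} {B₁ B₂ : RTy S Γ σ} {E₁ E₂ : RTy S Γ τ} :
      IsSubtype D B₁ B₂ → IsSubtype D E₁ E₂ → IsSubtype D (.sum B₁ E₁) (.sum B₂ E₂)

/-- The typing relation `Γ̇ ⊢ M : σ̇` of the refinement type system. -/
inductive Typed : {Γ : Ctx S} → {σ : Ty S.Base} → RCtx S Γ → Tm S Γ σ → RTy S Γ σ → Prop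
  | app {Γ : Ctx S} {σ : Ty S.Base} {D : RCtx S Γ} {M : Tm S Γ (.fn σ)} {N : Tm S Γ σ}
      {B : RTy S Γ σ} {φ : Fml S (.prop :: σ :: Γ)} :
      Typed D M (.pi B φ) → Typed D N B →
        Typed D (.app M N) (.refine .prop (φ.subst ((Sub.single N).lift _)))
  | lam {Γ : Ctx S} {σ : Ty S.Base} {D : RCtx S Γ} {M : Tm S (σ :: Γ) .prop}
      {B : RTy S Γ σ} {φ : Fml S (.prop :: σ :: Γ)} :
      Typed (D.cons B) M (.refine .prop φ) → Typed D (.lam M) (.pi B φ)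
  | unit {Γ : Ctx S} {D : RCtx S Γ} : Typed D .unit (.refine .unit .top)
  | pair {Γ : Ctx S} {σ τ : Ty S.Base} {D : RCtx S Γ} {M : Tm S Γ σ} {N : Tm S Γ τ}
      {B : RTy S Γ σ} {E : RTy S (σ :: Γ) τ} :
      Typed D M B → Typed D N (E.subst (Sub.single M)) → Typed D (.pair M N) (.sigma B E)
  | fst {Γ : Ctx S} {σ τ : Ty S.Base} {D : RCtx S Γ} {M : Tm S Γ (.prod σ τ)}
      {B : RTy S Γ σ} {E : RTy S (σ :: Γ) τ} :
      Typed D M (.sigma B E) → Typed D (.fst M) B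
  | snd {Γ : Ctx S} {σ τ : Ty S.Base} {D : RCtx S Γ} {M : Tm S Γ (.prod σ τ)}
      {B : RTy S Γ σ} {E : RTy S (σ :: Γ) τ} :
      Typed D M (.sigma B E) → Typed D (.snd M) (E.subst (Sub.single (.fst M)))
  | case0 {Γ : Ctx S} {τ : Ty S.Base} {D : RCtx S Γ} {M : Tm S Γ .empty} (E : RTy S Γ τ) :
      Typed D M .empty → Typed D (.case0 M) E
  | inl {Γ : Ctx S} {σ τ : Ty S.Base} {D : RCtx S Γ} {M : Tm S Γ σ} {B : RTy S Γ σ}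
      (E : RTy S Γ τ) : Typed D M B → Typed D (.inl M) (.sum B E)
  | inr {Γ : Ctx S} {σ τ : Ty S.Base} {D : RCtx S Γ} {M : Tm S Γ τ} (B : RTy S Γ σ)
      {E : RTy S Γ τ} : Typed D M E → Typed D (.inr M) (.sum B E)
  | case2 {Γ : Ctx S} {σ₁ σ₂ τ : Ty S.Base} {D : RCtx S Γ} {M : Tm S Γ (.sum σ₁ σ₂)}
      {N₁ : Tm S (σ₁ :: Γ) τ} {N₂ : Tm S (σ₂ :: Γ) τ} {B₁ : RTy S Γ σ₁} {B₂ : RTy S Γ σ₂}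
      (E : RTy S (.sum σ₁ σ₂ :: Γ) τ) :
      Typed D M (.sum B₁ B₂) →
      Typed (D.cons B₁) N₁ (E.subst (Sub.replace (.inl (.var .z)))) →
      Typed (D.cons B₂) N₂ (E.subst (Sub.replace (.inr (.var .z)))) →
        Typed D (.case2 M N₁ N₂) (E.subst (Sub.single M))
  | varRefine {Γ : Ctx S} {b : S.Base} {D : RCtx S Γ} (x : Var S Γ (.base b)) :
      Typed D (.var x)
        (.refine (.base b) (.atom (.eq b) (.pair (.var .z) (.var (.s x)))))
  | var {Γ : Ctx S} {σ : Ty S.Base} {D : RCtx S Γ} (x : Var S Γ σ) :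
      Typed D (.var x) (D.lookup x)
  | sub {Γ : Ctx S} {σ : Ty S.Base} {D : RCtx S Γ} {M : Tm S Γ σ} {B E : RTy S Γ σ} :
      Typed D M B → IsSubtype P D B E → Typed D M E
  | fix {Γ : Ctx S} {σ : Ty S.Base} {D : RCtx S Γ} {M : Tm S (.fn σ :: Γ) (.fn σ)}
      {B : RTy S Γ σ} {φ : Fml S (.prop :: σ :: Γ)} :
      Typed (D.cons (.pi B φ)) M ((RTy.pi B φ).subst (Sub.wk Γ (.fn σ))) →
      Admissible P φ → Typed D (.fix M) (.pi B φ)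
  | basicOp {Γ : Ctx S} {D : RCtx S Γ} (o : S.Op) {M : Tm S Γ (S.ar o)}
      {B : RTy S Γ (S.ar o)} {E : RTy S Γ (S.car o)} :
      Typed D M B →
      (∀ γ ∈ (D.cons B).sem P, γ ≫ A.ctx Γ ◁ A.op o ∈ (D.cons E).sem P) →
        Typed D (.op o M) E

/-- The closed formula `φ` is true in the model. -/
def IsTrue (φ : Fml S []) : Prop := φ.sem P = Set.univ

end Semantics

end HFL

/-!
The theorem is the closed instance of `HFL.Typed.sound`: if `Γ̇ ⊢ M : B` is derivable and the point
`γ` of `⟦Γ⟧` lies in `⟦Γ̇⟧`, then the point `⟦M⟧ ∘ γ` satisfies `B` at `γ`. The proof is by induction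
on the derivation.

`RTy.sem` carries along the predicate `Q` of the context, which gets in the way of substitution.
It only matters for the context component of a point, so each refinement type is replaced by a
relation `RTy.Sat` between points of `⟦Γ⟧` and points of `⟦σ⟧`, with `(γ, u) ∈ B.sem Q ↔ γ ∈ Q ∧
B.Sat γ u` (`RTy.mem_sem_cons_iff`). The dependent rules for application, pairs, second
projections and case expressions then rest on `RTy.sat_subst`: satisfying `B[s]` at `γ` is the
same as satisfying `B` at `⟦s⟧ ∘ γ`. This comes from the substitution lemma for terms,
`Model.tm_subst`, whose only cases with content are the binders: currying, distributivity of
products over coproducts, and the parameterised fixed point are natural in the context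
(`comp_curry_swap`, `comp_lift_leftDistrib_inv_desc`, `comp_dagger`).

The rule for `fix` is Scott induction (`Model.tm_fix_induction`): evaluation at a point is
Scott-continuous and sends the least function to `⊥`, so admissibility of `φ` makes the set of points
satisfying `(x : B) → {v : Prop | φ}` contain the least point and closed under suprema of chains.

A substitution is never given a canonical denotation; `Sub.Interp s h` says instead that the morphism
`h` agrees with `s` on variables, which is all the lemmas need.
-/

namespace HFL

/-! ### Composition, distributivity and fixed points -/

section Categories

variable {C : Type u} [Category.{v} C] [CartesianMonoidalCategory C] [MonoidalClosed C]

theorem lift_comp_curry_ev {X Y A B : C} (g : X ⟶ Y) (a : X ⟶ A) (m : A ⊗ Y ⟶ B) :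
    lift a (g ≫ MonoidalClosed.curry m) ≫ (ihom.ev A).app B = lift a g ≫ m := by
  rw [← lift_whiskerLeft, Category.assoc, MonoidalClosed.whiskerLeft_curry_ihom_ev_app]

theorem comp_botHom {A : C} {a : 𝟙_ C ⟶ A} {X Y : C} (h : X ⟶ Y) (B : C) :
    h ≫ botHom a Y B = botHom a X B := by
  rw [botHom, ← MonoidalClosed.curry_natural_left, ← Category.assoc, comp_toUnit, botHom]

theorem lift_botHom_ev {A : C} {a : 𝟙_ C ⟶ A} {X B : C} (b : X ⟶ B) :
    lift b (botHom a X B) ≫ (ihom.ev B).app A = toUnit X ≫ a := by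
  rw [← Category.id_comp (botHom a X B), botHom, lift_comp_curry_ev, ← Category.assoc,
    comp_toUnit]

variable [HasFiniteCoproducts C]

theorem whiskerRight_leftDistrib_inv {X Y A B : C} (h : X ⟶ Y) :
    h ▷ (A ⨿ B) ≫ (leftDistrib Y A B).inv =
      (leftDistrib X A B).inv ≫ coprod.map (h ▷ A) (h ▷ B) := by
  rw [Iso.comp_inv_eq, Category.assoc, Iso.eq_inv_comp]
  apply coprod.hom_ext
  · simp [← whisker_exchange]
  · simp [← whisker_exchange]

/-- The interpretation of a `case` expression is natural in the context. -/
theorem comp_lift_leftDistrib_inv_desc {X Y A B Z : C} (h : X ⟶ Y) (m : Y ⟶ A ⨿ B)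
    (n₁ : Y ⊗ A ⟶ Z) (n₂ : Y ⊗ B ⟶ Z) :
    h ≫ lift (𝟙 Y) m ≫ (leftDistrib Y A B).inv ≫ coprod.desc n₁ n₂ =
      lift (𝟙 X) (h ≫ m) ≫ (leftDistrib X A B).inv ≫
        coprod.desc (h ▷ A ≫ n₁) (h ▷ B ≫ n₂) := by
  rw [← coprod.map_desc, ← Category.assoc (leftDistrib X A B).inv,
    ← whiskerRight_leftDistrib_inv]
  simp [← Category.assoc, comp_lift, lift_whiskerRight]

theorem lift_inl_leftDistrib_inv_desc {X Y A B Z : C} (g : X ⟶ Y) (a : X ⟶ A)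
    (n₁ : Y ⊗ A ⟶ Z) (n₂ : Y ⊗ B ⟶ Z) :
    lift g (a ≫ coprod.inl) ≫ (leftDistrib Y A B).inv ≫ coprod.desc n₁ n₂ = lift g a ≫ n₁ := by
  rw [← lift_whiskerLeft, Category.assoc, whiskerLeft_coprod_inl_leftDistrib_inv_assoc,
    coprod.inl_desc]

theorem lift_inr_leftDistrib_inv_desc {X Y A B Z : C} (g : X ⟶ Y) (b : X ⟶ B)
    (n₁ : Y ⊗ A ⟶ Z) (n₂ : Y ⊗ B ⟶ Z) :
    lift g (b ≫ coprod.inr) ≫ (leftDistrib Y A B).inv ≫ coprod.desc n₁ n₂ = lift g b ≫ n₂ := by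
  rw [← lift_whiskerLeft, Category.assoc, whiskerLeft_coprod_inr_leftDistrib_inv_assoc,
    coprod.inr_desc]

variable [OmegaCPOEnriched C]

theorem comp_ωSup {X Y Z : C} (h : X ⟶ Y) (c : Chain (Y ⟶ Z)) :
    h ≫ ωSup c = ωSup (c.map ⟨fun g => h ≫ g, fun _ _ hg => comp_le_comp le_rfl hg⟩) :=
  ((OmegaCPOEnriched.comp_continuous X Y Z).comp
    (Prod.ωScottContinuous.prodMk (f := fun _ : Y ⟶ Z => h) ωScottContinuous.const
      ωScottContinuous.id)).map_ωSup c

theorem ωSup_comp {X Y Z : C} (c : Chain (X ⟶ Y)) (g : Y ⟶ Z) :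
    ωSup c ≫ g = ωSup (c.map ⟨fun h => h ≫ g, fun _ _ hh => comp_le_comp hh le_rfl⟩) :=
  ((OmegaCPOEnriched.comp_continuous X Y Z).comp
    (Prod.ωScottContinuous.prodMk (g := fun _ : X ⟶ Y => g) ωScottContinuous.id
      ωScottContinuous.const)).map_ωSup c

theorem lift_ωSup {X Y Z : C} (f : X ⟶ Y) (c : Chain (X ⟶ Z)) :
    lift f (ωSup c) =
      ωSup (c.map ⟨fun g => lift f g, fun _ _ hg => OmegaCPOEnriched.lift_mono le_rfl hg⟩) := by
  set d : Chain (X ⟶ Y ⊗ Z) :=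
    c.map ⟨fun g => lift f g, fun _ _ hg => OmegaCPOEnriched.lift_mono le_rfl hg⟩
  have hd : ∀ n, lift f (c n) ≤ ωSup d := fun n => le_ωSup d n
  refine le_antisymm ?_ (ωSup_le _ _ fun n =>
    OmegaCPOEnriched.lift_mono le_rfl (le_ωSup c n))
  -- `ωSup d` is the pairing of its two components, which lie above `f` and `ωSup c`
  have h1 : f ≤ ωSup d ≫ fst Y Z := by
    simpa using comp_le_comp (hd 0) (le_refl (fst Y Z))
  have h2 : ωSup c ≤ ωSup d ≫ snd Y Z := ωSup_le _ _ fun n => by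
    simpa using comp_le_comp (hd n) (le_refl (snd Y Z))
  simpa using OmegaCPOEnriched.lift_mono h1 h2

variable [AdmitsStrongLifting C] {A : C} {a : 𝟙_ C ⟶ A}

/-- Scott induction for the parameterised fixed point. -/
theorem dagger_induction (ha : IsBot a) {X B : C}
    (f : X ⊗ (ihom B).obj A ⟶ (ihom B).obj A) (p : (X ⟶ (ihom B).obj A) → Prop)
    (bot : p (botHom a X B)) (step : ∀ h, p h → p (lift (𝟙 X) h ≫ f))
    (sup : ∀ c : Chain (X ⟶ (ihom B).obj A), (∀ n, p (c n)) → p (ωSup c)) :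
    p (dagger ha f) := by
  refine sup _ fun n => ?_
  induction n with
  | zero => exact bot
  | succ n ih =>
    have : fixedPoints.iterateChain (fixStep f) (botHom a X B) (botHom_le ha _) (n + 1) =
        fixStep f (fixedPoints.iterateChain (fixStep f) (botHom a X B) (botHom_le ha _) n) :=
      Function.iterate_succ_apply' ..
    rw [this]
    exact step _ ih

/-- The parameterised fixed point is natural in the parameter. -/
theorem comp_dagger (ha : IsBot a) {X Y B : C} (h : X ⟶ Y)
    (f : Y ⊗ (ihom B).obj A ⟶ (ihom B).obj A) :
    h ≫ dagger ha f = dagger ha (h ▷ (ihom B).obj A ≫ f) := by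
  rw [dagger, comp_ωSup, dagger]
  congr 1
  ext n
  change h ≫ (fixStep f)^[n] (botHom a Y B) =
    (fixStep (h ▷ (ihom B).obj A ≫ f))^[n] (botHom a X B)
  induction n with
  | zero => exact comp_botHom h B
  | succ n ih =>
    rw [Function.iterate_succ_apply', Function.iterate_succ_apply', ← ih]
    change h ≫ lift (𝟙 Y) _ ≫ f = lift (𝟙 X) (h ≫ _) ≫ h ▷ (ihom B).obj A ≫ f
    rw [← Category.assoc, comp_lift, ← Category.assoc (lift (𝟙 X) _), lift_whiskerRight,
      Category.comp_id, Category.id_comp]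

end Categories

/-! ### Structural maps of the interpretation -/

theorem comp_curry_swap {C : Type u} [Category.{v} C] [CartesianMonoidalCategory C]
    [MonoidalClosed C] {X Y A B : C} (h : X ⟶ Y) (m : Y ⊗ A ⟶ B) :
    h ≫ MonoidalClosed.curry (lift (snd A Y) (fst A Y) ≫ m) =
      MonoidalClosed.curry (lift (snd A X) (fst A X) ≫ h ▷ A ≫ m) := by
  rw [← MonoidalClosed.curry_natural_left, ← Category.assoc, ← Category.assoc, comp_lift,
    lift_whiskerRight, whiskerLeft_snd, whiskerLeft_fst]

section Semantics

variable {S : Sig.{w}} {C : Type u} [Category.{v} C] [CartesianMonoidalCategory C]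
  [MonoidalClosed C] [HasFiniteCoproducts C] [OmegaCPOEnriched C]

/-- The morphism `h × ⟦τ⟧` of contexts extended by one variable. -/
noncomputable def Model.ctxMap (A : Model S C) {Γ Δ : Ctx S} (h : A.ctx Δ ⟶ A.ctx Γ)
    (τ : Ty S.Base) : A.ctx (τ :: Δ) ⟶ A.ctx (τ :: Γ) :=
  h ▷ A.ty τ

/-- The weakening morphism `⟦Γ, τ⟧ ⟶ ⟦Γ⟧`. -/
noncomputable def Model.proj (A : Model S C) (Γ : Ctx S) (τ : Ty S.Base) :
    A.ctx (τ :: Γ) ⟶ A.ctx Γ :=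
  fst (A.ctx Γ) (A.ty τ)

/-- The first projection `⟦σ × τ⟧ ⟶ ⟦σ⟧`. Like the structural maps below, it is given a type in
terms of `A.ty`, which unfolds to the categorical product only by definition. -/
noncomputable def Model.fst (A : Model S C) (σ τ : Ty S.Base) : A.ty (.prod σ τ) ⟶ A.ty σ :=
  CartesianMonoidalCategory.fst (A.ty σ) (A.ty τ)

/-- The second projection `⟦σ × τ⟧ ⟶ ⟦τ⟧`. -/
noncomputable def Model.snd (A : Model S C) (σ τ : Ty S.Base) : A.ty (.prod σ τ) ⟶ A.ty τ :=
  CartesianMonoidalCategory.snd (A.ty σ) (A.ty τ)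

/-- The first injection `⟦σ⟧ ⟶ ⟦σ + τ⟧`. -/
noncomputable def Model.inl (A : Model S C) (σ τ : Ty S.Base) : A.ty σ ⟶ A.ty (.sum σ τ) :=
  (coprod.inl : A.ty σ ⟶ A.ty σ ⨿ A.ty τ)

/-- The second injection `⟦τ⟧ ⟶ ⟦σ + τ⟧`. -/
noncomputable def Model.inr (A : Model S C) (σ τ : Ty S.Base) : A.ty τ ⟶ A.ty (.sum σ τ) :=
  (coprod.inr : A.ty τ ⟶ A.ty σ ⨿ A.ty τ)

/-- The value `ev(f, x)` of a point `f` of `⟦σ → Prop⟧` at a point `x` of `⟦σ⟧`. -/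
noncomputable def Model.ev (A : Model S C) {σ : Ty S.Base} (f : 𝟙_ C ⟶ A.ty (.fn σ))
    (x : 𝟙_ C ⟶ A.ty σ) : 𝟙_ C ⟶ A.ty .prop :=
  CartesianMonoidalCategory.lift x f ≫ (ihom.ev (A.ty σ)).app A.Ω

/-- The least point of `⟦σ → Prop⟧`. -/
noncomputable def Model.botFn (A : Model S C) (σ : Ty S.Base) : 𝟙_ C ⟶ A.ty (.fn σ) :=
  botHom A.bot (𝟙_ C) (A.ty σ)

theorem Model.ev_botFn (A : Model S C) {σ : Ty S.Base} (x : 𝟙_ C ⟶ A.ty σ) :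
    A.ev (A.botFn σ) x = A.bot :=
  (lift_botHom_ev x).trans (by rw [toUnit_unit, Category.id_comp])

theorem Model.ev_ωSup (A : Model S C) {σ : Ty S.Base} (c : Chain (𝟙_ C ⟶ A.ty (.fn σ)))
    (x : 𝟙_ C ⟶ A.ty σ) :
    A.ev (ωSup c) x = ωSup (c.map ⟨fun f => A.ev f x, fun _ _ hf =>
      comp_le_comp (OmegaCPOEnriched.lift_mono le_rfl hf) le_rfl⟩) :=
  (congrArg (· ≫ (ihom.ev (A.ty σ)).app A.Ω) (lift_ωSup x c)).trans (ωSup_comp _ _)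

theorem Model.cons_comp_ctxMap (A : Model S C) {Γ Δ : Ctx S} (h : A.ctx Δ ⟶ A.ctx Γ)
    {τ : Ty S.Base} (γ : 𝟙_ C ⟶ A.ctx Δ) (u : 𝟙_ C ⟶ A.ty τ) :
    A.cons γ u ≫ A.ctxMap h τ = A.cons (γ ≫ h) u :=
  lift_whiskerRight _ _ _

theorem Model.cons_comp_proj (A : Model S C) {Γ : Ctx S} {τ : Ty S.Base}
    (γ : 𝟙_ C ⟶ A.ctx Γ) (u : 𝟙_ C ⟶ A.ty τ) : A.cons γ u ≫ A.proj Γ τ = γ :=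
  lift_fst _ _

theorem Model.tail_cons (A : Model S C) {Γ : Ctx S} {τ : Ty S.Base}
    (γ : 𝟙_ C ⟶ A.ctx Γ) (u : 𝟙_ C ⟶ A.ty τ) : A.tail (A.cons γ u) = γ :=
  lift_fst _ _

theorem Model.head_cons (A : Model S C) {Γ : Ctx S} {τ : Ty S.Base}
    (γ : 𝟙_ C ⟶ A.ctx Γ) (u : 𝟙_ C ⟶ A.ty τ) : A.head (A.cons γ u) = u :=
  lift_snd _ _

theorem Model.cons_tail_head (A : Model S C) {Γ : Ctx S} {τ : Ty S.Base}
    (δ : 𝟙_ C ⟶ A.ctx (τ :: Γ)) : A.cons (A.tail δ) (A.head δ) = δ :=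
  lift_comp_fst_snd (X := 𝟙_ C) (Y := A.ctx Γ) (Z := A.ty τ) δ

/-! ### Renaming and substitution in terms -/

theorem Ren.var_lift (A : Model S C) {Γ Δ : Ctx S} {r : Ren Γ Δ} {h : A.ctx Δ ⟶ A.ctx Γ}
    (hr : ∀ σ (x : Var S Γ σ), A.var (r σ x) = h ≫ A.var x) (τ : Ty S.Base) :
    ∀ σ (x : Var S (τ :: Γ) σ), A.var (r.lift τ σ x) = A.ctxMap h τ ≫ A.var x
  | _, .z => (whiskerRight_snd h (A.ty τ)).symm
  | _, .s x => by
    change fst (A.ctx Δ) (A.ty τ) ≫ A.var (r _ x) =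
      h ▷ A.ty τ ≫ fst (A.ctx Γ) (A.ty τ) ≫ A.var x
    rw [hr, ← Category.assoc, ← Category.assoc, whiskerRight_fst]

variable [AdmitsStrongLifting C]

theorem Model.tm_rename (A : Model S C) {Γ Δ : Ctx S} {σ : Ty S.Base} (M : Tm S Γ σ)
    (r : Ren Γ Δ) (h : A.ctx Δ ⟶ A.ctx Γ)
    (hr : ∀ σ (x : Var S Γ σ), A.var (r σ x) = h ≫ A.var x) :
    A.tm (M.rename r) = h ≫ A.tm M := by
  induction M generalizing Δ with
  | var x => exact hr _ x
  | op o M ih => exact (congrArg (· ≫ _) (ih r h hr)).trans (Category.assoc _ _ _)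
  | unit => exact (comp_toUnit h).symm
  | pair M N ihM ihN =>
    exact (congrArg₂ lift (ihM r h hr) (ihN r h hr)).trans (comp_lift _ _ _).symm
  | fst M ih => exact (congrArg (· ≫ _) (ih r h hr)).trans (Category.assoc _ _ _)
  | snd M ih => exact (congrArg (· ≫ _) (ih r h hr)).trans (Category.assoc _ _ _)
  | case0 M ih => exact (congrArg (· ≫ _) (ih r h hr)).trans (Category.assoc _ _ _)
  | inl M ih => exact (congrArg (· ≫ _) (ih r h hr)).trans (Category.assoc _ _ _)
  | inr M ih => exact (congrArg (· ≫ _) (ih r h hr)).trans (Category.assoc _ _ _)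
  | case2 M N₁ N₂ ih ih₁ ih₂ =>
    simp only [Tm.rename, tm, ih r h hr, ih₁ _ _ (Ren.var_lift A hr _),
      ih₂ _ _ (Ren.var_lift A hr _)]
    exact (comp_lift_leftDistrib_inv_desc h (A.tm M) (A.tm N₁) (A.tm N₂)).symm
  | lam M ih =>
    simp only [Tm.rename, tm, ih _ _ (Ren.var_lift A hr _)]
    exact (comp_curry_swap h (A.tm M)).symm
  | app M N ihM ihN =>
    simp only [Tm.rename, tm, ihM r h hr, ihN r h hr, ← comp_lift]
    exact Category.assoc _ _ _
  | fix M ih =>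
    simp only [Tm.rename, tm, ih _ _ (Ren.var_lift A hr _)]
    exact (comp_dagger A.isBot h (A.tm M)).symm

/-- `h` interprets the substitution `s`. -/
def Sub.Interp (A : Model S C) {Γ Δ : Ctx S} (s : Sub Γ Δ) (h : A.ctx Δ ⟶ A.ctx Γ) : Prop :=
  ∀ σ (x : Var S Γ σ), A.tm (s σ x) = h ≫ A.var x

/-- An interpreted substitution can be carried under a binder. -/
theorem Sub.Interp.lift {A : Model S C} {Γ Δ : Ctx S} {s : Sub Γ Δ} {h : A.ctx Δ ⟶ A.ctx Γ}
    (hs : s.Interp A h) (τ : Ty S.Base) : (s.lift τ).Interp A (A.ctxMap h τ)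
  | _, .z => (whiskerRight_snd h (A.ty τ)).symm
  | _, .s x => by
    change A.tm ((s _ x).rename fun _ y => .s y) =
      h ▷ A.ty τ ≫ CartesianMonoidalCategory.fst (A.ctx Γ) (A.ty τ) ≫ A.var x
    rw [A.tm_rename (s _ x) _ (A.proj Δ τ) fun _ _ => rfl, hs, ← Category.assoc,
      ← Category.assoc, whiskerRight_fst]
    rfl

theorem Sub.interp_wk (A : Model S C) (Γ : Ctx S) (τ : Ty S.Base) :
    (Sub.wk Γ τ).Interp A (A.proj Γ τ) :=
  fun _ _ => rfl

/-- The morphism `⟨id, ⟦M⟧⟩` that interprets the substitution of `M` for the last variable. -/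
noncomputable def Model.extend (A : Model S C) {Γ : Ctx S} {τ : Ty S.Base} (M : Tm S Γ τ) :
    A.ctx Γ ⟶ A.ctx (τ :: Γ) :=
  CartesianMonoidalCategory.lift (𝟙 (A.ctx Γ)) (A.tm M)

/-- The morphism `⟦Γ, τ⟧ ⟶ ⟦Γ, ρ⟧` that keeps `Γ` and has `⟦M⟧` as its last component. -/
noncomputable def Model.replace (A : Model S C) {Γ : Ctx S} {ρ τ : Ty S.Base}
    (M : Tm S (τ :: Γ) ρ) : A.ctx (τ :: Γ) ⟶ A.ctx (ρ :: Γ) :=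
  CartesianMonoidalCategory.lift (A.proj Γ τ) (A.tm M)

theorem Model.comp_extend (A : Model S C) {Γ : Ctx S} {τ : Ty S.Base} (M : Tm S Γ τ)
    (γ : 𝟙_ C ⟶ A.ctx Γ) : γ ≫ A.extend M = A.cons γ (γ ≫ A.tm M) :=
  (comp_lift _ _ _).trans (congrArg (CartesianMonoidalCategory.lift · _) (Category.comp_id γ))

theorem Model.cons_comp_replace (A : Model S C) {Γ : Ctx S} {ρ τ : Ty S.Base}
    (M : Tm S (τ :: Γ) ρ) (γ : 𝟙_ C ⟶ A.ctx Γ) (x : 𝟙_ C ⟶ A.ty τ) :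
    A.cons γ x ≫ A.replace M = A.cons γ (A.cons γ x ≫ A.tm M) :=
  (comp_lift _ _ _).trans
    (congrArg (CartesianMonoidalCategory.lift · _) (A.cons_comp_proj γ x))

theorem Sub.interp_single (A : Model S C) {Γ : Ctx S} {τ : Ty S.Base} (M : Tm S Γ τ) :
    (Sub.single M).Interp A (A.extend M)
  | _, .z => (lift_snd _ _).symm
  | _, .s x => by
    change A.var x = CartesianMonoidalCategory.lift (𝟙 (A.ctx Γ)) (A.tm M) ≫
      CartesianMonoidalCategory.fst (A.ctx Γ) (A.ty τ) ≫ A.var x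
    rw [← Category.assoc, lift_fst, Category.id_comp]

theorem Sub.interp_replace (A : Model S C) {Γ : Ctx S} {ρ τ : Ty S.Base}
    (M : Tm S (τ :: Γ) ρ) :
    (Sub.replace M).Interp A (A.replace M)
  | _, .z => (lift_snd _ _).symm
  | _, .s x => by
    change A.proj Γ τ ≫ A.var x = CartesianMonoidalCategory.lift (A.proj Γ τ) (A.tm M) ≫
      CartesianMonoidalCategory.fst (A.ctx Γ) (A.ty ρ) ≫ A.var x
    rw [← Category.assoc, lift_fst]

theorem Model.tm_subst (A : Model S C) {Γ Δ : Ctx S} {σ : Ty S.Base} (M : Tm S Γ σ)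
    {s : Sub Γ Δ} {h : A.ctx Δ ⟶ A.ctx Γ} (hs : s.Interp A h) :
    A.tm (M.subst s) = h ≫ A.tm M := by
  induction M generalizing Δ with
  | var x => exact hs _ x
  | op o M ih => exact (congrArg (· ≫ _) (ih hs)).trans (Category.assoc _ _ _)
  | unit => exact (comp_toUnit h).symm
  | pair M N ihM ihN =>
    exact (congrArg₂ lift (ihM hs) (ihN hs)).trans (comp_lift _ _ _).symm
  | fst M ih => exact (congrArg (· ≫ _) (ih hs)).trans (Category.assoc _ _ _)
  | snd M ih => exact (congrArg (· ≫ _) (ih hs)).trans (Category.assoc _ _ _)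
  | case0 M ih => exact (congrArg (· ≫ _) (ih hs)).trans (Category.assoc _ _ _)
  | inl M ih => exact (congrArg (· ≫ _) (ih hs)).trans (Category.assoc _ _ _)
  | inr M ih => exact (congrArg (· ≫ _) (ih hs)).trans (Category.assoc _ _ _)
  | case2 M N₁ N₂ ih ih₁ ih₂ =>
    simp only [Tm.subst, tm, ih hs, ih₁ (hs.lift _), ih₂ (hs.lift _)]
    exact (comp_lift_leftDistrib_inv_desc h (A.tm M) (A.tm N₁) (A.tm N₂)).symm
  | lam M ih =>
    simp only [Tm.subst, tm, ih (hs.lift _)]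
    exact (comp_curry_swap h (A.tm M)).symm
  | app M N ihM ihN =>
    simp only [Tm.subst, tm, ihM hs, ihN hs, ← comp_lift]
    exact Category.assoc _ _ _
  | fix M ih =>
    simp only [Tm.subst, tm, ih (hs.lift _)]
    exact (comp_dagger A.isBot h (A.tm M)).symm

/-! ### Terms at a point of the context -/

section Points

variable (A : Model S C) {Γ : Ctx S} {σ τ : Ty S.Base} (γ : 𝟙_ C ⟶ A.ctx Γ)

theorem Model.cons_comp_tm_var_z (x : 𝟙_ C ⟶ A.ty σ) : A.cons γ x ≫ A.tm (.var .z) = x :=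
  lift_snd _ _

theorem Model.cons_comp_tm_var_s (x : 𝟙_ C ⟶ A.ty σ) (y : Var S Γ τ) :
    A.cons γ x ≫ A.tm (.var (.s y)) = γ ≫ A.tm (.var y) :=
  (Category.assoc _ _ _).symm.trans (congrArg (· ≫ A.var y) (lift_fst _ _))

theorem Model.comp_tm_pair_fst (M : Tm S Γ σ) (N : Tm S Γ τ) :
    (γ ≫ A.tm (.pair M N)) ≫ A.fst σ τ = γ ≫ A.tm M :=
  (Category.assoc _ _ _).trans (congrArg (γ ≫ ·) (lift_fst _ _))

theorem Model.comp_tm_pair_snd (M : Tm S Γ σ) (N : Tm S Γ τ) :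
    (γ ≫ A.tm (.pair M N)) ≫ A.snd σ τ = γ ≫ A.tm N :=
  (Category.assoc _ _ _).trans (congrArg (γ ≫ ·) (lift_snd _ _))

theorem Model.comp_tm_fst (M : Tm S Γ (.prod σ τ)) :
    γ ≫ A.tm (.fst M) = (γ ≫ A.tm M) ≫ A.fst σ τ :=
  (Category.assoc _ _ _).symm

theorem Model.comp_tm_snd (M : Tm S Γ (.prod σ τ)) :
    γ ≫ A.tm (.snd M) = (γ ≫ A.tm M) ≫ A.snd σ τ :=
  (Category.assoc _ _ _).symm

theorem Model.comp_tm_inl (M : Tm S Γ σ) :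
    γ ≫ A.tm (.inl (τ := τ) M) = (γ ≫ A.tm M) ≫ A.inl σ τ :=
  (Category.assoc _ _ _).symm

theorem Model.comp_tm_inr (M : Tm S Γ τ) :
    γ ≫ A.tm (.inr (σ := σ) M) = (γ ≫ A.tm M) ≫ A.inr σ τ :=
  (Category.assoc _ _ _).symm

theorem Model.comp_tm_app (M : Tm S Γ (.fn σ)) (N : Tm S Γ σ) :
    γ ≫ A.tm (.app M N) = A.ev (γ ≫ A.tm M) (γ ≫ A.tm N) :=
  (Category.assoc _ _ _).symm.trans
    (congrArg (· ≫ (ihom.ev (A.ty σ)).app A.Ω) (comp_lift γ (A.tm N) (A.tm M)))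

theorem Model.ev_comp_tm_lam (M : Tm S (σ :: Γ) .prop) (x : 𝟙_ C ⟶ A.ty σ) :
    A.ev (γ ≫ A.tm (.lam M)) x = A.cons γ x ≫ A.tm M := by
  refine (lift_comp_curry_ev γ x _).trans ((Category.assoc _ _ _).symm.trans ?_)
  refine congrArg (· ≫ A.tm M) ((comp_lift _ _ _).trans ?_)
  rw [lift_snd, lift_fst]

theorem Model.comp_tm_case2 {σ₁ σ₂ : Ty S.Base} (M : Tm S Γ (.sum σ₁ σ₂))
    (N₁ : Tm S (σ₁ :: Γ) τ) (N₂ : Tm S (σ₂ :: Γ) τ) :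
    γ ≫ A.tm (.case2 M N₁ N₂) = CartesianMonoidalCategory.lift γ (γ ≫ A.tm M) ≫
      (leftDistrib (A.ctx Γ) (A.ty σ₁) (A.ty σ₂)).inv ≫ coprod.desc (A.tm N₁) (A.tm N₂) :=
  (Category.assoc _ _ _).symm.trans (congrArg (· ≫ _)
    ((comp_lift _ _ _).trans (congrArg (lift · _) (Category.comp_id γ))))

theorem Model.comp_tm_case2_of_inl {σ₁ σ₂ : Ty S.Base} (M : Tm S Γ (.sum σ₁ σ₂))
    (N₁ : Tm S (σ₁ :: Γ) τ) (N₂ : Tm S (σ₂ :: Γ) τ) {x : 𝟙_ C ⟶ A.ty σ₁}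
    (h : γ ≫ A.tm M = x ≫ A.inl σ₁ σ₂) :
    γ ≫ A.tm (.case2 M N₁ N₂) = A.cons γ x ≫ A.tm N₁ := by
  rw [A.comp_tm_case2, h]
  exact lift_inl_leftDistrib_inv_desc γ x (A.tm N₁) (A.tm N₂)

theorem Model.comp_tm_case2_of_inr {σ₁ σ₂ : Ty S.Base} (M : Tm S Γ (.sum σ₁ σ₂))
    (N₁ : Tm S (σ₁ :: Γ) τ) (N₂ : Tm S (σ₂ :: Γ) τ) {y : 𝟙_ C ⟶ A.ty σ₂}
    (h : γ ≫ A.tm M = y ≫ A.inr σ₁ σ₂) :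
    γ ≫ A.tm (.case2 M N₁ N₂) = A.cons γ y ≫ A.tm N₂ := by
  rw [A.comp_tm_case2, h]
  exact lift_inr_leftDistrib_inv_desc γ y (A.tm N₁) (A.tm N₂)

theorem Model.comp_tm_op (o : S.Op) (M : Tm S Γ (S.ar o)) :
    A.cons γ (γ ≫ A.tm M) ≫ A.ctx Γ ◁ A.op o = A.cons γ (γ ≫ A.tm (.op o M)) :=
  (lift_whiskerLeft _ _ _).trans (congrArg (lift γ) (Category.assoc _ _ _))

/-- Scott induction for the points `⟦fix f. M⟧ ∘ γ`: an admissible property preserved by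
`f ↦ ⟦M⟧ ∘ (γ, f)` holds there. -/
theorem Model.tm_fix_induction (M : Tm S (.fn σ :: Γ) (.fn σ))
    (p : (𝟙_ C ⟶ A.ty (.fn σ)) → Prop) (bot : p (A.botFn σ))
    (step : ∀ f, p f → p (A.cons γ f ≫ A.tm M))
    (sup : ∀ c : Chain (𝟙_ C ⟶ A.ty (.fn σ)), (∀ n, p (c n)) → p (ωSup c)) :
    p (γ ≫ A.tm (.fix M)) := by
  refine dagger_induction A.isBot (A.tm M) (fun h => p (γ ≫ h)) ?_ (fun h hh => ?_)
    fun c hc => ?_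
  · exact (comp_botHom γ (A.ty σ)).symm ▸ bot
  · have e : γ ≫ lift (𝟙 (A.ctx Γ)) h ≫ A.tm M = A.cons (σ := .fn σ) γ (γ ≫ h) ≫ A.tm M :=
      (Category.assoc _ _ _).symm.trans (congrArg (· ≫ A.tm M)
        ((comp_lift _ _ _).trans (congrArg (lift · _) (Category.comp_id γ))))
    exact e.symm ▸ step _ hh
  · exact (comp_ωSup γ c).symm ▸ sup _ hc

end Points

/-! ### Semantic substitution in formulas -/

variable {A : Model S C} (P : PredInterp A)

theorem Fml.mem_sem_atom {Γ : Ctx S} (a : Atom S) (M : Tm S Γ a.ar) (γ : 𝟙_ C ⟶ A.ctx Γ) :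
    γ ∈ (Fml.atom a M).sem P ↔ γ ≫ A.tm M ∈ P.atom a := by
  rw [Fml.sem, Set.mem_ofPred_eq]

theorem Fml.mem_sem_subst {Γ Δ : Ctx S} (φ : Fml S Γ) {s : Sub Γ Δ} {h : A.ctx Δ ⟶ A.ctx Γ}
    (hs : s.Interp A h) (γ : 𝟙_ C ⟶ A.ctx Δ) :
    γ ∈ (φ.subst s).sem P ↔ γ ≫ h ∈ φ.sem P := by
  induction φ generalizing Δ with
  | atom a M =>
    rw [Fml.subst, Fml.mem_sem_atom, Fml.mem_sem_atom, A.tm_subst M hs]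
    exact iff_of_eq (congrArg (· ∈ P.atom a) (Category.assoc _ _ _).symm)
  | top => simp only [Fml.subst, Fml.sem, Set.mem_univ]
  | bot => simp only [Fml.subst, Fml.sem, Set.mem_empty_iff_false]
  | imp φ ψ ihφ ihψ => simp only [Fml.subst, Fml.sem, Set.mem_ofPred_eq, ihφ hs, ihψ hs]
  | and φ ψ ihφ ihψ => simp only [Fml.subst, Fml.sem, Set.mem_inter_iff, ihφ hs, ihψ hs]
  | or φ ψ ihφ ihψ => simp only [Fml.subst, Fml.sem, Set.mem_union, ihφ hs, ihψ hs]

/-! ### Refinement types as predicates on pairs of points -/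

/-- The point `u` of `⟦σ⟧` satisfies the refinement type `B` at the point `γ` of `⟦Γ⟧`. This is the
part of `RTy.sem` that does not depend on the predicate of the context. -/
def RTy.Sat : {Γ : Ctx S} → {σ : Ty S.Base} → RTy S Γ σ → (𝟙_ C ⟶ A.ctx Γ) →
    (𝟙_ C ⟶ A.ty σ) → Prop
  | _, _, .refine _ φ, γ, u => A.cons γ u ∈ φ.sem P
  | _, _, .pi (σ := σ) B φ, γ, f => ∀ x : 𝟙_ C ⟶ A.ty σ, B.Sat γ x →
      A.cons (A.cons γ x) (A.ev f x) ∈ φ.sem P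
  | _, _, .sigma (σ := σ) (τ := τ) B E, γ, p =>
      B.Sat γ (p ≫ A.fst σ τ) ∧ E.Sat (A.cons γ (p ≫ A.fst σ τ)) (p ≫ A.snd σ τ)
  | _, _, .empty, _, _ => False
  | _, _, .sum (σ := σ) (τ := τ) B E, γ, u =>
      (∃ x, B.Sat γ x ∧ u = x ≫ A.inl σ τ) ∨ ∃ y, E.Sat γ y ∧ u = y ≫ A.inr σ τ

/-- `RTy.sem` is determined by `RTy.Sat`: the predicate `Q` of the context only constrains the
context component of a point. -/
theorem RTy.mem_sem_cons_iff {Γ : Ctx S} {σ : Ty S.Base} (B : RTy S Γ σ)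
    (Q : Set (𝟙_ C ⟶ A.ctx Γ)) (γ : 𝟙_ C ⟶ A.ctx Γ) (u : 𝟙_ C ⟶ A.ty σ) :
    A.cons γ u ∈ B.sem P Q ↔ γ ∈ Q ∧ B.Sat P γ u := by
  induction B with
  | refine hσ φ =>
    change A.tail (A.cons γ u) ∈ Q ∧ _ ↔ _
    rw [A.tail_cons]
    rfl
  | @pi Γ σ B φ ih =>
    change A.tail (A.cons γ u) ∈ Q ∧ (∀ x : 𝟙_ C ⟶ A.ty σ,
      A.cons (A.tail (A.cons γ u)) x ∈ B.sem P Q →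
        A.tail (A.cons (A.cons (A.tail (A.cons γ u)) x) (A.ev (A.head (A.cons γ u)) x)) ∈
            B.sem P Q ∧
          A.cons (A.cons (A.tail (A.cons γ u)) x) (A.ev (A.head (A.cons γ u)) x) ∈
            φ.sem P) ↔ _
    simp only [A.tail_cons, A.head_cons, ih]
    exact and_congr_right fun hγ => forall_congr' fun x =>
      ⟨fun h hx => (h ⟨hγ, hx⟩).2, fun h hx => ⟨hx, h hx.2⟩⟩
  | @sigma Γ σ τ B E ihB ihE =>
    change A.cons (A.cons (A.tail (A.cons γ u)) (A.head (A.cons γ u) ≫ A.fst σ τ))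
        (A.head (A.cons γ u) ≫ A.snd σ τ) ∈ E.sem P (B.sem P Q) ↔ _
    rw [A.tail_cons, A.head_cons, ihE, ihB, and_assoc]
    rfl
  | empty => exact ⟨False.elim, fun h => h.2⟩
  | @sum Γ σ τ B E ihB ihE =>
    have key : ∀ {ρ : Ty S.Base} (F : RTy S Γ ρ) (i : A.ty ρ ⟶ A.ty σ ⨿ A.ty τ),
        (∀ v, A.cons γ v ∈ F.sem P Q ↔ γ ∈ Q ∧ F.Sat P γ v) →
        ((∃ f ∈ F.sem P Q, (A.cons (σ := .sum σ τ) γ u : 𝟙_ C ⟶ A.ctx Γ ⊗ (A.ty σ ⨿ A.ty τ)) =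
          f ≫ A.ctx Γ ◁ i) ↔ γ ∈ Q ∧ ∃ x, F.Sat P γ x ∧ u = x ≫ i) := by
      intro ρ F i hF
      constructor
      · rintro ⟨f, hf, h⟩
        obtain ⟨v, w, rfl⟩ : ∃ v w, f = A.cons v w := ⟨_, _, (A.cons_tail_head f).symm⟩
        have h' : lift γ u = lift v (w ≫ i) := h.trans (lift_whiskerLeft v w i)
        obtain rfl : γ = v := (lift_fst γ u).symm.trans
          ((congrArg (· ≫ fst (A.ctx Γ) (A.ty σ ⨿ A.ty τ)) h').trans (lift_fst _ _))
        have hu : u = w ≫ i := (lift_snd γ u).symm.trans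
          ((congrArg (· ≫ snd (A.ctx Γ) (A.ty σ ⨿ A.ty τ)) h').trans (lift_snd _ _))
        exact ⟨((hF w).1 hf).1, w, ((hF w).1 hf).2, hu⟩
      · rintro ⟨hγ, x, hx, rfl⟩
        exact ⟨A.cons γ x, (hF x).2 ⟨hγ, hx⟩, (lift_whiskerLeft γ x i).symm⟩
    exact (or_congr (key B coprod.inl (ihB Q γ)) (key E coprod.inr (ihE Q γ))).trans
      and_or_left.symm

/-- Substitution in a refinement type is interpreted by moving the point of the context. -/
theorem RTy.sat_subst {Γ Δ : Ctx S} {σ : Ty S.Base} (B : RTy S Γ σ) {s : Sub Γ Δ}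
    {h : A.ctx Δ ⟶ A.ctx Γ} (hs : s.Interp A h) (γ : 𝟙_ C ⟶ A.ctx Δ) (u : 𝟙_ C ⟶ A.ty σ) :
    (B.subst s).Sat P γ u ↔ B.Sat P (γ ≫ h) u := by
  induction B generalizing Δ with
  | refine hσ φ =>
    change A.cons γ u ∈ (φ.subst (s.lift _)).sem P ↔ A.cons (γ ≫ h) u ∈ φ.sem P
    rw [φ.mem_sem_subst P (hs.lift _), A.cons_comp_ctxMap]
  | pi B φ ih =>
    simp only [RTy.subst, RTy.Sat, ih hs, φ.mem_sem_subst P ((hs.lift _).lift _),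
      A.cons_comp_ctxMap]
  | sigma B E ihB ihE =>
    simp only [RTy.subst, RTy.Sat, ihB hs, ihE (hs.lift _), A.cons_comp_ctxMap]
  | empty => exact Iff.rfl
  | sum B E ihB ihE => simp only [RTy.subst, RTy.Sat, ihB hs, ihE hs]

theorem RTy.sat_wk {Γ : Ctx S} {σ τ : Ty S.Base} (B : RTy S Γ σ) (γ : 𝟙_ C ⟶ A.ctx Γ)
    (x : 𝟙_ C ⟶ A.ty τ) (u : 𝟙_ C ⟶ A.ty σ) :
    (B.subst (Sub.wk Γ τ)).Sat P (A.cons γ x) u ↔ B.Sat P γ u := by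
  rw [B.sat_subst P (Sub.interp_wk A Γ τ), A.cons_comp_proj]

theorem RTy.sat_single {Γ : Ctx S} {σ τ : Ty S.Base} (E : RTy S (τ :: Γ) σ) (M : Tm S Γ τ)
    (γ : 𝟙_ C ⟶ A.ctx Γ) (u : 𝟙_ C ⟶ A.ty σ) :
    (E.subst (Sub.single M)).Sat P γ u ↔ E.Sat P (A.cons γ (γ ≫ A.tm M)) u := by
  rw [E.sat_subst P (Sub.interp_single A M), A.comp_extend]

end Semantics

/-! ### Soundness of subtyping and typing -/

section Semantics

variable {S : Sig.{w}} {C : Type u} [Category.{v} C] [CartesianMonoidalCategory C]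
  [MonoidalClosed C] [HasFiniteCoproducts C] [OmegaCPOEnriched C] [AdmitsStrongLifting C]
  {A : Model S C} {P : PredInterp A}

theorem IsSubtype.sound {Γ : Ctx S} {σ : Ty S.Base} {D : RCtx S Γ} {B E : RTy S Γ σ}
    (h : IsSubtype P D B E) {γ : 𝟙_ C ⟶ A.ctx Γ} (hγ : γ ∈ D.sem P) {u : 𝟙_ C ⟶ A.ty σ}
    (hu : B.Sat P γ u) : E.Sat P γ u := by
  induction h with
  | refl => exact hu
  | trans _ _ ih₁ ih₂ => exact ih₂ hγ (ih₁ hγ hu)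
  | @refine Γ σ D hσ φ ψ hφ =>
    exact hφ (((RTy.refine hσ φ).mem_sem_cons_iff P (D.sem P) γ u).2 ⟨hγ, hu⟩)
  | @pi Γ σ D B₁ B₂ φ₁ φ₂ _ _ ih₁ ih₂ =>
    exact fun x hx => ih₂ ((B₂.mem_sem_cons_iff P _ γ x).2 ⟨hγ, hx⟩) (hu x (ih₁ hγ hx))
  | @sigma Γ σ τ D B₁ B₂ E₁ E₂ _ _ ih₁ ih₂ =>
    exact ⟨ih₁ hγ hu.1, ih₂ ((B₁.mem_sem_cons_iff P _ γ _).2 ⟨hγ, hu.1⟩) hu.2⟩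
  | sum _ _ ih₁ ih₂ =>
    obtain ⟨x, hx, h⟩ | ⟨y, hy, h⟩ := hu
    · exact .inl ⟨x, ih₁ hγ hx, h⟩
    · exact .inr ⟨y, ih₂ hγ hy, h⟩

theorem RCtx.sat_lookup {Γ : Ctx S} (D : RCtx S Γ) {σ : Ty S.Base} (x : Var S Γ σ)
    {γ : 𝟙_ C ⟶ A.ctx Γ} (hγ : γ ∈ D.sem P) : (D.lookup x).Sat P γ (γ ≫ A.var x) := by
  induction D with
  | nil => nomatch x
  | @cons Γ τ D B ih =>
    obtain ⟨γ, u, rfl⟩ : ∃ γ' u, γ = A.cons γ' u := ⟨_, _, (A.cons_tail_head γ).symm⟩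
    obtain ⟨h, hu⟩ := (B.mem_sem_cons_iff P _ γ u).1 hγ
    cases x with
    | z =>
      refine (B.sat_wk P γ u _).2 ?_
      have : A.cons γ u ≫ A.var .z = u := lift_snd _ _
      rwa [this]
    | s x =>
      refine ((D.lookup x).sat_wk P γ u _).2 ?_
      have : A.cons γ u ≫ A.var (.s x) = γ ≫ A.var x :=
        (Category.assoc _ _ _).symm.trans (congrArg (· ≫ A.var x) (lift_fst _ _))
      rw [this]
      exact ih x h

/-- If `φ` is admissible, the least point of `⟦σ → Prop⟧` satisfies `(x : B) → {v : Prop | φ}`. -/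
theorem RTy.sat_pi_botFn {Γ : Ctx S} {σ : Ty S.Base} (B : RTy S Γ σ)
    {φ : Fml S (.prop :: σ :: Γ)} (hφ : Admissible P φ) (γ : 𝟙_ C ⟶ A.ctx Γ) :
    (RTy.pi B φ).Sat P γ (A.botFn σ) := by
  intro x _
  rw [A.ev_botFn]
  exact (hφ _).1

/-- If `φ` is admissible, the points satisfying `(x : B) → {v : Prop | φ}` are closed under suprema
of chains, since these are computed pointwise. -/
theorem RTy.sat_pi_ωSup {Γ : Ctx S} {σ : Ty S.Base} (B : RTy S Γ σ)
    {φ : Fml S (.prop :: σ :: Γ)} (hφ : Admissible P φ) (γ : 𝟙_ C ⟶ A.ctx Γ)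
    (c : Chain (𝟙_ C ⟶ A.ty (.fn σ))) (hc : ∀ n, (RTy.pi B φ).Sat P γ (c n)) :
    (RTy.pi B φ).Sat P γ (ωSup c) := by
  intro x hx
  rw [A.ev_ωSup]
  exact (hφ _).2 _ fun n => hc n x hx

/-- A derivable typing judgement holds at every point of its context. -/
theorem Typed.sound {Γ : Ctx S} {σ : Ty S.Base} {D : RCtx S Γ} {M : Tm S Γ σ} {B : RTy S Γ σ}
    (h : Typed P D M B) {γ : 𝟙_ C ⟶ A.ctx Γ} (hγ : γ ∈ D.sem P) :
    B.Sat P γ (γ ≫ A.tm M) := by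
  induction h with
  | @app Γ σ D M N B φ _ _ ihM ihN =>
    refine (φ.mem_sem_subst P ((Sub.interp_single A N).lift _) _).2 ?_
    rw [A.cons_comp_ctxMap, A.comp_extend, A.comp_tm_app]
    exact ihM hγ _ (ihN hγ)
  | @lam Γ σ D M B φ _ ih =>
    intro x hx
    rw [A.ev_comp_tm_lam]
    exact ih ((B.mem_sem_cons_iff P _ γ x).2 ⟨hγ, hx⟩)
  | unit => simp only [RTy.Sat, Fml.sem, Set.mem_univ]
  | @pair Γ σ τ D M N B E _ _ ihM ihN =>
    rw [RTy.Sat, A.comp_tm_pair_fst, A.comp_tm_pair_snd]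
    exact ⟨ihM hγ, (E.sat_single P M γ _).1 (ihN hγ)⟩
  | @fst Γ σ τ D M B E _ ih =>
    rw [A.comp_tm_fst]
    exact (ih hγ).1
  | @snd Γ σ τ D M B E _ ih =>
    rw [E.sat_single P, A.comp_tm_fst, A.comp_tm_snd]
    exact (ih hγ).2
  | case0 E _ ih => exact (ih hγ).elim
  | inl E _ ih => exact .inl ⟨_, ih hγ, A.comp_tm_inl γ _⟩
  | inr B _ ih => exact .inr ⟨_, ih hγ, A.comp_tm_inr γ _⟩
  | @case2 Γ σ₁ σ₂ τ D M N₁ N₂ B₁ B₂ E _ _ _ ih ih₁ ih₂ =>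
    rw [E.sat_single P]
    -- A point of a coproduct may factor through both injections; either factorisation will do.
    obtain ⟨x, hx, h⟩ | ⟨y, hy, h⟩ := ih hγ
    · have hN := ih₁ ((B₁.mem_sem_cons_iff P _ γ x).2 ⟨hγ, hx⟩)
      rwa [E.sat_subst P (Sub.interp_replace A _), A.cons_comp_replace, A.comp_tm_inl,
        A.cons_comp_tm_var_z, ← h, ← A.comp_tm_case2_of_inl γ M N₁ N₂ h] at hN
    · have hN := ih₂ ((B₂.mem_sem_cons_iff P _ γ y).2 ⟨hγ, hy⟩)
      rwa [E.sat_subst P (Sub.interp_replace A _), A.cons_comp_replace, A.comp_tm_inr,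
        A.cons_comp_tm_var_z, ← h, ← A.comp_tm_case2_of_inr γ M N₁ N₂ h] at hN
  | @varRefine Γ b D x =>
    exact (Fml.mem_sem_atom P _ _ _).2 <| (A.comp_tm_pair_fst _ _ _).trans <|
      (A.cons_comp_tm_var_z γ _).trans <| (A.cons_comp_tm_var_s γ _ x).symm.trans
        (A.comp_tm_pair_snd _ _ _).symm
  | var x => exact RCtx.sat_lookup _ x hγ
  | sub _ hs ih => exact hs.sound hγ (ih hγ)
  | @fix Γ σ D M B φ _ hφ ih =>
    refine A.tm_fix_induction γ M _ (B.sat_pi_botFn hφ γ) (fun f hf => ?_)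
      (B.sat_pi_ωSup hφ γ)
    exact ((RTy.pi B φ).sat_wk P γ f _).1
      (ih (((RTy.pi B φ).mem_sem_cons_iff P _ γ f).2 ⟨hγ, hf⟩))
  | @basicOp Γ D o M B E _ ho ih =>
    have h := ho (A.cons γ (γ ≫ A.tm M)) ((B.mem_sem_cons_iff P _ γ _).2 ⟨hγ, ih hγ⟩)
    rw [A.comp_tm_op] at h
    exact ((E.mem_sem_cons_iff P _ γ _).1 h).2

end Semantics

end HFL

theorem mainTheorem2 {S : HFL.Sig.{w}} {C : Type u} [Category.{v} C]
    [CartesianMonoidalCategory C] [MonoidalClosed C] [HasFiniteCoproducts C]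
    [HFL.OmegaCPOEnriched C] [HFL.AdmitsStrongLifting C]
    (A : HFL.Model S C) (P : HFL.PredInterp A)
    {σ : HFL.Ty S.Base} (hσ : σ.IsGround) (M : HFL.Tm S [] σ) (φ : HFL.Fml S [σ])
    (hM : HFL.Typed P HFL.RCtx.nil M (HFL.RTy.refine hσ φ)) :
    HFL.IsTrue P (φ.subst (HFL.Sub.single M)) := by
  refine Set.eq_univ_of_forall fun γ => ?_
  have h : A.cons γ (γ ≫ A.tm M) ∈ φ.sem P := hM.sound (Set.mem_univ γ)
  rw [φ.mem_sem_subst P (HFL.Sub.interp_single A M), A.comp_extend]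
  exact h
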